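/- Let $n\ge 1$, $m=2n$, and consider undirected Hamiltonian cycles (identified with their edge sets) of the $m\times m$ square grid graph $P_m\times P_m$, with rows and columns numbered $1,\dots,m$. Let $B$ be the number of such cycles that are invariant under reflection in the horizontal axis of the square, $C$ the number of those invariant under $180^\circ$ rotation, and $D$ the number of those invariant under both reflections (in the horizontal and in the vertical axis) and under $180^\circ$ rotation. A *(connectivity) state* $s$ is a set of rows (those having a horizontal edge between two given adjacent columns) together with a perfect matching of this set (which records how these edges are linked by paths to the left). A *continuation* $t(s;s')$ is a set $V$ of vertical edges in a column of $m$ nodes such that, with the horizontal edges of $s$ on the left and those of $s'$ on the right, every node of the column has exactly two edges, the links of $s$ together with $V$ contain no closed loop, and $s'$ links two of its rows exactly when they are the two ends of a path formed by the links of $s$ and the edges of $V$. Let $\mathbf T$ be the matrix indexed by states, acting on column vectors, whose entry in row $s'$ and column $s$ is $1$ if a continuation $t(s;s')$ exists and $0$ otherwise. A state is *starting* if it is generated by the leftmost column, i.e. if there is a continuation to it from the state with no edges. It is *ending* if vertical edges in one further column can be chosen so that every node of that column has exactly two edges and the links of the state together with these vertical edges form a single cycle through all nodes of the column. Let $\alpha,\omega$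 be the $0/1$ characteristic vectors of starting and ending states, $\lambda$ that of the states with exactly one pair of horizontal edges, and $\mu$ that of the states $s$ such that $s$ and its reflection $s^{\mathrm{f}}$ in the horizontal axis have the same, non-empty set of horizontal edges and the links of $s$ and of $s^{\mathrm{f}}$ together form a single cycle visiting all of these edges (that is, the paths on the left and their copy rotated by $180^\circ$ close to a single cycle). Let $\bar{\mathbf T},\bar\alpha,\bar\omega,\bar\lambda,\bar\mu$ be obtained by keeping only the states and continuations that are symmetric under reflection in the horizontal axis. Then the number of Hamiltonian cycles invariant under reflection in the vertical axis also equals $B$, and $$B=\bar\omega^{T}\,\bar{\mathbf T}^{\,2n-2}\,\bar\alpha=\lambda^{T}\,\mathbf T^{\,n-1}\,\alpha,\qquad C=\mu^{T}\,\mathbf T^{\,n-1}\,\alpha,\qquad D=\bar\lambda^{T}\,\bar{\mathbf T}^{\,n-1}\,\bar\alpha .$$ Moreover $\bar\mu=\bar\lambda$, and a state has exactly one pair of horizontal edges if and only if its set of horizontal edges is non-empty and its links together with those of its mirror image in the vertical axis form a single cycle visiting all of its horizontal edges. -/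

import Mathlib

open scoped Matrix

namespace GridCycle

/-! ### Hamiltonian cycles of the square grid -/

/-- The `m × m` square grid graph; the node `(r, c)` lies in row `r` and column `c`. -/
def grid (m : ℕ) : SimpleGraph (Fin m × Fin m) :=
  SimpleGraph.boxProd (SimpleGraph.pathGraph m) (SimpleGraph.pathGraph m)

/-- The undirected Hamiltonian cycles of the grid, each one identified with its set of edges
(so that the choice of a base point and of a direction does not matter). -/
def hamCycles (m : ℕ) : Set (Set (Sym2 (Fin m × Fin m))) :=
  {E | ∃ (v : Fin m × Fin m) (p : (grid m).Walk v v),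
    p.IsHamiltonianCycle ∧ E = {e | e ∈ p.edges}}

/-- Reflection of the square in its horizontal axis (rows are reversed). -/
def reflH {m : ℕ} (p : Fin m × Fin m) : Fin m × Fin m := (p.1.rev, p.2)

/-- Reflection of the square in its vertical axis (columns are reversed). -/
def reflV {m : ℕ} (p : Fin m × Fin m) : Fin m × Fin m := (p.1, p.2.rev)

/-- Rotation of the square by 180 degrees. -/
def rot180 {m : ℕ} (p : Fin m × Fin m) : Fin m × Fin m := (p.1.rev, p.2.rev)

/-- The edge set `E` is mapped onto itself by the map `f` of the nodes. -/
def InvariantUnder {m : ℕ} (f : Fin m × Fin m → Fin m × Fin m)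
    (E : Set (Sym2 (Fin m × Fin m))) : Prop :=
  Sym2.map f '' E = E

/-- The number of Hamiltonian cycles with (at least) reflection symmetry in the horizontal axis. -/
noncomputable def countBH (m : ℕ) : ℕ :=
  {E | E ∈ hamCycles m ∧ InvariantUnder reflH E}.ncard

/-- The number of Hamiltonian cycles with (at least) reflection symmetry in the vertical axis. -/
noncomputable def countBV (m : ℕ) : ℕ :=
  {E | E ∈ hamCycles m ∧ InvariantUnder reflV E}.ncard

/-- The number of Hamiltonian cycles with (at least) 180 degree rotational symmetry. -/
noncomputable def countC (m : ℕ) : ℕ :=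
  {E | E ∈ hamCycles m ∧ InvariantUnder rot180 E}.ncard

/-- The number of Hamiltonian cycles with (at least) both reflection symmetries and 180 degree
rotational symmetry. -/
noncomputable def countD (m : ℕ) : ℕ :=
  {E | E ∈ hamCycles m ∧ InvariantUnder reflH E ∧ InvariantUnder reflV E ∧
    InvariantUnder rot180 E}.ncard

/-! ### Connectivity states and continuations -/

/-- A connectivity state between two adjacent columns of `m` nodes, written as an involution `s`
of the rows: `s r ≠ r` means that there is a horizontal edge in row `r` and that it is connected,
by a path to the left, to the horizontal edge in row `s r`; and `s r = r` means that there is no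
horizontal edge in row `r`. -/
abbrev State (m : ℕ) : Type := {s : Fin m → Fin m // ∀ r, s (s r) = r}

namespace State

variable {m : ℕ}

/-- The state has a horizontal edge in row `r`. -/
def HasEdge (s : State m) (r : Fin m) : Prop := s.1 r ≠ r

/-- The graph on the rows that joins two rows when the state links their horizontal edges. -/
def links (s : State m) : SimpleGraph (Fin m) where
  Adj r r' := r ≠ r' ∧ s.1 r = r'
  symm := ⟨fun r r' h => ⟨h.1.symm, by rw [← h.2]; exact s.2 r⟩⟩
  loopless := ⟨fun _ h => h.1 rfl⟩

/-- The state without any horizontal edge: this is what lies to the left of the first column. -/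
def empty (m : ℕ) : State m := ⟨id, fun _ => rfl⟩

/-- The reflection of a state in the horizontal axis. -/
def flip (s : State m) : State m :=
  ⟨fun r => (s.1 r.rev).rev, fun r => by simp [s.2]⟩

/-- The state is symmetric under reflection in the horizontal axis. -/
def IsSymmetric (s : State m) : Prop := s.flip = s

instance (s : State m) : Decidable s.IsSymmetric :=
  inferInstanceAs (Decidable (s.flip = s))

open Classical in
/-- The number (0 or 1) of horizontal edges of the state at row `r`. -/
noncomputable def deg (s : State m) (r : Fin m) : ℕ := if s.HasEdge r then 1 else 0

/-- `V` is a continuation `t(s; s')`: a set of vertical edges, in the column to the right of `s`,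
with which every node of the column has exactly two edges (to the left, in the column, or to the
right), no closed loop arises, and the next state is `s'`.

As every node has exactly two edges, each component made of the paths on the left (`s.links`) and
of the vertical edges `V` either is a closed loop, and then no node of it has an edge to the right,
or is a path, and then its two ends are the nodes that have an edge to the right. The condition
`open_paths` excludes the loops, and `next` says that `s'` links the two ends of each path. -/
structure IsContinuation (s : State m) (V : SimpleGraph (Fin m)) (s' : State m) : Prop where
  vertical : V ≤ SimpleGraph.pathGraph m
  degree_two : ∀ r, s.deg r + (V.neighborSet r).ncard + s'.deg r = 2
  open_paths : ∀ r, ∃ r', s'.HasEdge r' ∧ (s.links ⊔ V).Reachable r r'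
  next : ∀ r, s'.HasEdge r → (s.links ⊔ V).Reachable r (s'.1 r)

/-- A starting state: it can be generated by the leftmost column, to the left of which there are
no edges. -/
def IsStarting (s : State m) : Prop := ∃ V, IsContinuation (empty m) V s

/-- An ending state: it can be made into a complete Hamiltonian cycle by vertical edges in the
rightmost column. Every node of that column then has exactly two edges, and the paths on the left
and the vertical edges together form a single cycle through the nodes of the column. -/
def IsEnding (s : State m) : Prop :=
  ∃ V : SimpleGraph (Fin m), V ≤ SimpleGraph.pathGraph m ∧
    (∀ r, s.deg r + (V.neighborSet r).ncard = 2) ∧ (s.links ⊔ V).Connected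

/-- The state consists of exactly one pair of horizontal edges. -/
def IsSinglePair (s : State m) : Prop := {r | s.HasEdge r}.ncard = 2

/-- The paths on the left of the central position, in state `s`, and paths on the right of it,
whose mirror image is in state `t`, join to a single cycle: both have the same horizontal edges, and
following the links of `s` and those of `t` in turn visits all of these edges. -/
def Closes (s t : State m) : Prop :=
  (∀ r, s.HasEdge r ↔ t.HasEdge r) ∧ (∃ r, s.HasEdge r) ∧
    ∀ r r', s.HasEdge r → s.HasEdge r' → (s.links ⊔ t.links).Reachable r r'

/-- The paths on the left of the central position, in state `s`, and their mirror image in the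
vertical axis join to a single cycle. -/
def ClosesByReflection (s : State m) : Prop := s.Closes s

/-- The paths on the left of the central position, in state `s`, and their copy rotated by
180 degrees join to a single cycle; the rotation is the composition of the reflections in the
vertical axis and in the horizontal axis. -/
def ClosesByRotation (s : State m) : Prop := s.Closes s.flip

end State

/-- The states that are symmetric under reflection in the horizontal axis. -/
abbrev SymState (m : ℕ) : Type := {s : State m // s.IsSymmetric}

/-- A set of vertical edges that is symmetric under reflection in the horizontal axis. -/
def IsSymmetricColumn {m : ℕ} (V : SimpleGraph (Fin m)) : Prop :=
  ∀ r r', V.Adj r.rev r'.rev ↔ V.Adj r r'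

/-! ### Transfer matrices and vectors

Vectors are columns and `T` acts on the left, so that `(T *ᵥ ν) j = ∑ i, T j i * ν i`: the entry
`T j i` is the one of the step from the state `i` to the state `j`. -/

open Classical in
/-- The transfer matrix. -/
noncomputable def T (m : ℕ) : Matrix (State m) (State m) ℕ :=
  Matrix.of fun s' s => if ∃ V, State.IsContinuation s V s' then 1 else 0

open Classical in
/-- The characteristic function of the starting states. -/
noncomputable def alpha (m : ℕ) (s : State m) : ℕ := if s.IsStarting then 1 else 0

open Classical in
/-- The characteristic function of the ending states. -/
noncomputable def omega (m : ℕ) (s : State m) : ℕ := if s.IsEnding then 1 else 0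

open Classical in
/-- The characteristic function of the single-pair states. -/
noncomputable def lam (m : ℕ) (s : State m) : ℕ := if s.IsSinglePair then 1 else 0

open Classical in
/-- The characteristic function of the states that close to a single cycle by 180 degree
rotation. -/
noncomputable def mu (m : ℕ) (s : State m) : ℕ := if s.ClosesByRotation then 1 else 0

open Classical in
/-- The transfer matrix restricted to symmetric states and symmetric continuations. -/
noncomputable def TBar (m : ℕ) : Matrix (SymState m) (SymState m) ℕ :=
  Matrix.of fun s' s =>
    if ∃ V, State.IsContinuation s.1 V s'.1 ∧ IsSymmetricColumn V then 1 else 0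

/-- `alpha` restricted to the symmetric states. -/
noncomputable def alphaBar (m : ℕ) (s : SymState m) : ℕ := alpha m s.1

/-- `omega` restricted to the symmetric states. -/
noncomputable def omegaBar (m : ℕ) (s : SymState m) : ℕ := omega m s.1

/-- `lam` restricted to the symmetric states. -/
noncomputable def lamBar (m : ℕ) (s : SymState m) : ℕ := lam m s.1

/-- `mu` restricted to the symmetric states. -/
noncomputable def muBar (m : ℕ) (s : SymState m) : ℕ := mu m s.1

end GridCycle

/-!
A Hamiltonian cycle of the grid is the same thing as a connected spanning subgraph `H` in which
every node has degree 2 (`exists_isHamiltonianCycle_iff`). Cut such a graph between two adjacent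
columns. The part to the left of the cut has degrees at most 2 and contains no closed component, so
it consists of paths, and each of them has exactly two ends at the cut: by the handshaking lemma the
number of ends of a component is even, and a connected graph on `k` vertices has at least `k - 1`
edges, so that it is at most two. Hence `H` has a state at every cut
(`IsBoundary.exists_isCap`, `exists_atCut`), and the state is unique (`IsCap.eq`).

Connectivity to the left of a cut can be computed one column at a time: two nodes of the new column
are connected in the enlarged left part exactly when they are connected by the links of the old
state and the vertical edges of the new column (`IsColumnStep.reachable_iff`). For the nontrivial
direction, every node is labelled by a row of the new column to which it is connected, and
adjacent nodes get labels that are connected. Consequently consecutive states are related by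
continuations (`AtCut.isContinuation`), and conversely a sequence of continuations gives the states
of the graph assembled from it (`AtCut.succ`). Connectivity of the whole graph is read off in
the same way, either at the last column (`AtCut.connected_iff`) or, for a graph that is
invariant under a map exchanging left and right, at the central cut, where the two halves have to
close to a single cycle (`AtCut.connected_iff_closes`).

The horizontal edges determine the vertical ones through the degrees (`eq_of_hor_iff`). So
Hamiltonian cycles correspond to sequences of states up to the last cut, and invariant ones to
sequences up to the central cut; these are the two instances of `IsCutScheme`. In both cases the cycle is
symmetric under reflection in the horizontal axis exactly when all its states are
(`IsCutScheme.inv_reflH_iff`), as the reflection carries states to reflected states. Powers of the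
0/1 transfer matrices count the sequences (`ncard_isSeq`).
-/

namespace GridCycle

open SimpleGraph

/-! ### Hamiltonian cycles as connected 2-regular subgraphs -/

section General

variable {W : Type*}

/-- Every vertex of `H` has exactly two neighbours. -/
def IsTwoRegular (H : SimpleGraph W) : Prop := ∀ v, (H.neighborSet v).ncard = 2

/-- The edge sets of the Hamiltonian cycles of `G` are those of its connected 2-regular spanning
subgraphs. -/
theorem exists_isHamiltonianCycle_iff [Finite W] [DecidableEq W] (G : SimpleGraph W)
    (E : Set (Sym2 W)) :
    (∃ (v : W) (p : G.Walk v v), p.IsHamiltonianCycle ∧ E = {e | e ∈ p.edges}) ↔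
      ∃ H : SimpleGraph W, H ≤ G ∧ IsTwoRegular H ∧ H.Connected ∧ E = H.edgeSet := by
  constructor
  · rintro ⟨v, p, hp, rfl⟩
    refine ⟨p.toSubgraph.spanningCoe, p.toSubgraph.spanningCoe_le, fun w => ?_, ?_, ?_⟩
    · exact hp.isCycle.ncard_neighborSet_toSubgraph_eq_two (hp.mem_support w)
    · have hs : p.toSubgraph.IsSpanning := fun w => by
        rw [Walk.mem_verts_toSubgraph]; exact hp.mem_support w
      exact ((Subgraph.spanningCoeEquivCoeOfSpanning _ hs).connected_iff).2
        p.toSubgraph_connected.coe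
    · ext e
      induction e with
      | h a b => exact Walk.adj_toSubgraph_iff_mem_edges.symm
  · rintro ⟨H, hle, h2, hc, rfl⟩
    obtain ⟨v⟩ := hc.nonempty
    have hcyc : H.IsCycles := fun v _ => h2 v
    obtain ⟨p, hp, hv⟩ := hcyc.exists_cycle_toSubgraph_verts_eq_connectedComponentSupp
      (c := H.connectedComponentMk v) (v := v) rfl
      (Set.nonempty_of_ncard_ne_zero (by rw [h2 v]; norm_num))
    have hmem : ∀ w, w ∈ p.support := fun w => by
      rw [← Walk.mem_verts_toSubgraph, hv]
      exact ConnectedComponent.sound (hc w v)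
    refine ⟨v, p.mapLe hle, ?_, ?_⟩
    · rw [Walk.isHamiltonianCycle_iff_isCycle_and_support_count_tail_eq_one]
      refine ⟨hp.mapLe hle, fun a => ?_⟩
      rw [Walk.support_mapLe_eq_support]
      refine List.count_eq_one_of_mem hp.support_nodup ?_
      rcases (Walk.mem_support_iff p).1 (hmem a) with rfl | h
      · exact Walk.end_mem_tail_support hp.not_nil
      · exact h
    · ext e
      rw [Set.mem_ofPred_eq, Walk.edges_mapLe_eq_edges]
      induction e with
      | h a b =>
        rw [← Walk.adj_toSubgraph_iff_mem_edges, mem_edgeSet]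
        -- the cycle uses both edges at each of its vertices
        have : p.toSubgraph.neighborSet a = H.neighborSet a :=
          Set.eq_of_subset_of_ncard_le (p.toSubgraph.neighborSet_subset a)
            (by rw [h2, hp.ncard_neighborSet_toSubgraph_eq_two (hmem a)]) (Set.toFinite _)
        exact (Set.ext_iff.1 this b).symm

/-! ### Components of graphs of degree at most two -/

/-- A vertex of degree 1 has another vertex of degree 1 in its component, if all degrees are at
most 2. -/
theorem exists_ne_reachable_of_ncard_neighborSet_eq_one [Finite W] {G : SimpleGraph W}
    (h2 : ∀ v, (G.neighborSet v).ncard ≤ 2) {v : W} (hv : (G.neighborSet v).ncard = 1) :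
    ∃ w, w ≠ v ∧ (G.neighborSet w).ncard = 1 ∧ G.Reachable v w := by
  classical
  have := Fintype.ofFinite W
  -- the handshaking lemma is applied to the component of `v`
  let G' : SimpleGraph W :=
    { Adj := fun a b => G.Adj a b ∧ G.Reachable v a
      symm := ⟨fun a b h => ⟨h.1.symm, h.2.trans h.1.reachable⟩⟩
      loopless := ⟨fun a h => G.loopless.irrefl a h.1⟩ }
  have hdeg : ∀ a, G.Reachable v a → G'.degree a = (G.neighborSet a).ncard := fun a ha => by
    rw [← card_neighborSet_eq_degree, ← Nat.card_eq_fintype_card, Nat.card_coe_set_eq]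
    congr 1
    ext b
    exact ⟨fun h => h.1, fun h => ⟨h, ha⟩⟩
  obtain ⟨w, hwv, hw⟩ := G'.exists_ne_odd_degree_of_exists_odd_degree v
    (by rw [hdeg v (Reachable.refl v), hv]; exact odd_one)
  have hr : G.Reachable v w := by
    obtain ⟨b, hb⟩ := (G'.degree_pos_iff_exists_adj w).1 hw.pos
    exact hb.2
  refine ⟨w, hwv, ?_, hr⟩
  rw [hdeg w hr] at hw
  have := h2 w
  obtain ⟨k, hk⟩ := hw
  omega

/-- A connected graph with all degrees at most 2 has at most two vertices of degree less
than 2. -/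
theorem false_of_three_ends_of_connected [Finite W] {G : SimpleGraph W} (hG : G.Connected)
    (h2 : ∀ v, (G.neighborSet v).ncard ≤ 2) {a b c : W} (hab : a ≠ b) (hac : a ≠ c) (hbc : b ≠ c)
    (ha : (G.neighborSet a).ncard ≤ 1) (hb : (G.neighborSet b).ncard ≤ 1)
    (hc : (G.neighborSet c).ncard ≤ 1) : False := by
  classical
  have := Fintype.ofFinite W
  have hdeg : ∀ a, G.degree a = (G.neighborSet a).ncard := fun a => by
    rw [← card_neighborSet_eq_degree, ← Nat.card_eq_fintype_card, Nat.card_coe_set_eq]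
  have hsum := G.sum_degrees_eq_twice_card_edges
  have hcard := hG.card_vert_le_card_edgeSet_add_one
  rw [Nat.card_eq_fintype_card, Nat.card_eq_fintype_card, ← edgeFinset_card] at hcard
  have hle : ∑ v, (G.degree v + if v ∈ ({a, b, c} : Finset W) then 1 else 0) ≤ ∑ _v : W, 2 := by
    refine Finset.sum_le_sum fun v _ => ?_
    rw [hdeg]
    split_ifs with h
    · simp only [Finset.mem_insert, Finset.mem_singleton] at h
      rcases h with rfl | rfl | rfl <;> omega
    · exact h2 v
  rw [Finset.sum_add_distrib, hsum] at hle
  have h3 : ∑ v : W, (if v ∈ ({a, b, c} : Finset W) then 1 else 0) = 3 := by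
    rw [Finset.sum_ite_mem, Finset.univ_inter, Finset.sum_const, smul_eq_mul, mul_one]
    exact Finset.card_eq_three.2 ⟨a, b, c, hab, hac, hbc, rfl⟩
  rw [h3, Finset.sum_const, Finset.card_univ, smul_eq_mul] at hle
  omega

/-- A component of a graph with all degrees at most 2 has at most two vertices of degree less
than 2. -/
theorem false_of_three_ends [Finite W] {G : SimpleGraph W}
    (h2 : ∀ v, (G.neighborSet v).ncard ≤ 2) {a b c : W} (hab : a ≠ b) (hac : a ≠ c) (hbc : b ≠ c)
    (ha : (G.neighborSet a).ncard ≤ 1) (hb : (G.neighborSet b).ncard ≤ 1)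
    (hc : (G.neighborSet c).ncard ≤ 1) (rab : G.Reachable a b) (rac : G.Reachable a c) : False := by
  let C := G.connectedComponentMk a
  have hle : ∀ x : C, (C.toSimpleGraph.neighborSet x).ncard ≤ (G.neighborSet x.1).ncard :=
    fun x => by
      rw [← Set.ncard_image_of_injective _ Subtype.val_injective]
      refine Set.ncard_le_ncard ?_ (Set.toFinite _)
      rintro _ ⟨y, hy, rfl⟩
      exact hy
  refine false_of_three_ends_of_connected C.connected_toSimpleGraph (fun x => (hle x).trans (h2 _))
    (a := ⟨a, rfl⟩) (b := ⟨b, ConnectedComponent.sound rab.symm⟩)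
    (c := ⟨c, ConnectedComponent.sound rac.symm⟩) ?_ ?_ ?_ ((hle _).trans ha) ((hle _).trans hb)
    ((hle _).trans hc)
  · exact fun h => hab (congrArg Subtype.val h)
  · exact fun h => hac (congrArg Subtype.val h)
  · exact fun h => hbc (congrArg Subtype.val h)

/-- A map of vertices that sends adjacent vertices to connected ones preserves reachability. -/
theorem reachable_map {ι : Type*} {G : SimpleGraph W} {K : SimpleGraph ι} (f : W → ι)
    (hf : ∀ u v, G.Adj u v → K.Reachable (f u) (f v)) {u v : W} (h : G.Reachable u v) :
    K.Reachable (f u) (f v) := by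
  obtain ⟨p⟩ := h
  induction p with
  | nil => exact Reachable.refl _
  | cons h _ ih => exact (hf _ _ h).trans ih

end General

/-! ### The state of a graph at a cut -/

section Caps

variable {W : Type*} {m : ℕ}

theorem State.HasEdge.apply {s : State m} {r : Fin m} (h : s.HasEdge r) : s.HasEdge (s.1 r) :=
  fun h' => h (by rw [s.2] at h'; exact h'.symm)

/-- The edges of `H` with both ends in `A`. -/
def within (H : SimpleGraph W) (A : Set W) : SimpleGraph W where
  Adj u v := H.Adj u v ∧ u ∈ A ∧ v ∈ A
  symm := ⟨fun _ _ h => ⟨h.1.symm, h.2.2, h.2.1⟩⟩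
  loopless := ⟨fun _ h => H.loopless.irrefl _ h.1⟩

theorem within_mono (H : SimpleGraph W) {A B : Set W} (h : A ⊆ B) : within H A ≤ within H B :=
  fun _ _ h' => ⟨h'.1, h h'.2.1, h h'.2.2⟩

@[simp] theorem within_univ (H : SimpleGraph W) : within H Set.univ = H := by
  ext; simp [within]

/-- The part `A` of `H`, which is left through the nodes `e r` with a horizontal edge in row `r`,
is in state `s`: it consists of paths between these nodes, and `s` links the two ends of each
path. The values of `e` at rows without an edge are irrelevant. -/
structure IsCap (H : SimpleGraph W) (A : Set W) (e : Fin m → W) (s : State m) : Prop where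
  reach : ∀ v ∈ A, ∃ r, s.HasEdge r ∧ (within H A).Reachable v (e r)
  linked : ∀ r, s.HasEdge r → (within H A).Reachable (e r) (e (s.1 r))
  sep : ∀ r r', s.HasEdge r → s.HasEdge r' → (within H A).Reachable (e r) (e r') →
    r' = r ∨ r' = s.1 r

theorem IsCap.eq {H : SimpleGraph W} {A : Set W} {e : Fin m → W} {s t : State m}
    (hs : IsCap H A e s) (ht : IsCap H A e t) (hst : ∀ r, s.HasEdge r ↔ t.HasEdge r) : s = t := by
  refine Subtype.ext (funext fun r => ?_)
  by_cases h : s.HasEdge r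
  · exact (ht.sep r (s.1 r) ((hst r).1 h) ((hst _).1 h.apply) (hs.linked r h)).resolve_left h
  · have h' := (hst r).not.1 h
    rw [State.HasEdge, not_not] at h h'
    rw [h, h']

/-- The state is carried along by a graph isomorphism `τ` that acts on the rows by `σ`. -/
theorem IsCap.transport {H H' : SimpleGraph W} {A A' : Set W} {e e' : Fin m → W} {s t : State m}
    (hs : IsCap H A e s) (τ : W ≃ W) (σ : Fin m ≃ Fin m)
    (hτ : ∀ u v, H'.Adj (τ u) (τ v) ↔ H.Adj u v) (hA : ∀ v, τ v ∈ A' ↔ v ∈ A)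
    (he : ∀ r, e' (σ r) = τ (e r)) (ht : ∀ r, t.1 (σ r) = σ (s.1 r)) : IsCap H' A' e' t := by
  have hedge : ∀ r, t.HasEdge (σ r) ↔ s.HasEdge r := fun r => by
    rw [State.HasEdge, ht, σ.injective.ne_iff]; rfl
  let φ : within H A ≃g within H' A' :=
    { toEquiv := τ
      map_rel_iff' := fun {u v} => by
        change (H'.Adj (τ u) (τ v) ∧ τ u ∈ A' ∧ τ v ∈ A') ↔ _
        rw [hτ, hA, hA]; rfl }
  have hr : ∀ u v, (within H' A').Reachable (τ u) (τ v) ↔ (within H A).Reachable u v :=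
    fun u v => φ.reachable_iff
  constructor
  · intro v hv
    obtain ⟨v, rfl⟩ := τ.surjective v
    obtain ⟨r, h1, h2⟩ := hs.reach v ((hA v).1 hv)
    exact ⟨σ r, (hedge r).2 h1, by rw [he, hr]; exact h2⟩
  · intro r h
    obtain ⟨r, rfl⟩ := σ.surjective r
    rw [ht, he, he, hr]
    exact hs.linked r ((hedge r).1 h)
  · intro r r' h h' hrr
    obtain ⟨r, rfl⟩ := σ.surjective r
    obtain ⟨r', rfl⟩ := σ.surjective r'
    rw [he, he, hr] at hrr
    rw [ht, σ.injective.eq_iff, σ.injective.eq_iff]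
    exact hs.sep r r' ((hedge r).1 h) ((hedge r').1 h') hrr

/-- Ends of the same path are linked, also in any graph that contains the links. -/
theorem IsCap.reachable_links {H : SimpleGraph W} {A : Set W} {e : Fin m → W} {s : State m}
    (hs : IsCap H A e s) {K : SimpleGraph (Fin m)} (hK : s.links ≤ K) {r r' : Fin m}
    (h : s.HasEdge r) (h' : s.HasEdge r') (hr : (within H A).Reachable (e r) (e r')) :
    K.Reachable r r' := by
  rcases hs.sep r r' h h' hr with rfl | rfl
  · exact Reachable.refl _
  · exact (hK (show s.links.Adj r (s.1 r) from ⟨fun h0 => h h0.symm, rfl⟩)).reachable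

/-- A part `A` of `H` in state `s`, followed by a column of nodes `e r` that is joined to `A`
along the horizontal edges of `s` and in which `V` is the set of vertical edges. -/
structure IsColumnStep (H : SimpleGraph W) (A : Set W) (e : Fin m → W) (s : State m)
    (V : SimpleGraph (Fin m)) (e' : Fin m → W) : Prop where
  cap : IsCap H A e s
  mem : ∀ r, s.HasEdge r → e r ∈ A
  inj : Function.Injective e'
  notMem : ∀ r, e' r ∉ A
  adj : ∀ r r', H.Adj (e' r) (e' r') ↔ V.Adj r r'
  cross : ∀ u ∈ A, ∀ r, H.Adj u (e' r) ↔ u = e r ∧ s.HasEdge r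

namespace IsColumnStep

variable {H : SimpleGraph W} {A : Set W} {e e' : Fin m → W} {s : State m}
  {V : SimpleGraph (Fin m)}

/-- Connectivity in the part extended by a column is that of the links and the vertical edges. -/
theorem reachable_iff (h : IsColumnStep H A e s V e') (r r' : Fin m) :
    (within H (A ∪ Set.range e')).Reachable (e' r) (e' r') ↔ (s.links ⊔ V).Reachable r r' := by
  classical
  constructor
  · -- every node is labelled by a row of the new column to which it is connected
    let f : W → Fin m := fun v =>
      if hv : v ∈ A then (h.cap.reach v hv).choose else if hv : ∃ r, e' r = v then hv.choose else r
    have fA : ∀ v ∈ A, s.HasEdge (f v) ∧ (within H A).Reachable v (e (f v)) := fun v hv => by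
      simp only [f, dif_pos hv]
      exact (h.cap.reach v hv).choose_spec
    have fe : ∀ r, f (e' r) = r := fun r => by
      have hx : ∃ r', e' r' = e' r := ⟨r, rfl⟩
      simp only [f, dif_neg (h.notMem r), dif_pos hx]
      exact h.inj hx.choose_spec
    have hcross : ∀ u ∈ A, ∀ r, H.Adj u (e' r) → (s.links ⊔ V).Reachable (f u) r :=
      fun u hu r hur => by
        obtain ⟨rfl, hr⟩ := (h.cross u hu r).1 hur
        exact h.cap.reachable_links le_sup_left (fA _ hu).1 hr (fA _ hu).2.symm
    intro hr
    have key := reachable_map (K := s.links ⊔ V) f (fun u v huv => ?_) hr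
    · rwa [fe, fe] at key
    · obtain ⟨hadj, hu | ⟨a, rfl⟩, hv | ⟨b, rfl⟩⟩ := huv
      · refine h.cap.reachable_links le_sup_left (fA u hu).1 (fA v hv).1 ?_
        exact ((fA u hu).2.symm.trans
          (show (within H A).Adj u v from ⟨hadj, hu, hv⟩).reachable).trans (fA v hv).2
      · rw [fe]; exact hcross u hu b hadj
      · rw [fe]; exact (hcross v hv a hadj.symm).symm
      · rw [fe, fe]
        exact (show (s.links ⊔ V).Adj a b from Or.inr ((h.adj a b).1 hadj)).reachable
  · refine fun hr => reachable_map e' (fun a b hab => ?_) hr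
    have he : ∀ x, e' x ∈ A ∪ Set.range e' := fun x => Or.inr ⟨x, rfl⟩
    rcases hab with ⟨hne, rfl⟩ | hab
    · have ha : s.HasEdge a := fun h => hne h.symm
      have h1 : (within H (A ∪ Set.range e')).Adj (e a) (e' a) :=
        ⟨(h.cross _ (h.mem a ha) a).2 ⟨rfl, ha⟩, Or.inl (h.mem a ha), he a⟩
      have h2 : (within H (A ∪ Set.range e')).Adj (e (s.1 a)) (e' (s.1 a)) :=
        ⟨(h.cross _ (h.mem _ ha.apply) _).2 ⟨rfl, ha.apply⟩, Or.inl (h.mem _ ha.apply), he _⟩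
      exact (h1.symm.reachable.trans
        ((h.cap.linked a ha).mono (within_mono H Set.subset_union_left))).trans h2.reachable
    · exact (show (within H (A ∪ Set.range e')).Adj (e' a) (e' b) from
        ⟨(h.adj a b).2 hab, he a, he b⟩).reachable

/-- Every node of the extended part is connected to the new column. -/
theorem exists_reachable (h : IsColumnStep H A e s V e') {v : W} (hv : v ∈ A ∪ Set.range e') :
    ∃ r, (within H (A ∪ Set.range e')).Reachable v (e' r) := by
  rcases hv with hv | ⟨r, rfl⟩
  · obtain ⟨r, hr, hvr⟩ := h.cap.reach v hv
    refine ⟨r, (hvr.mono (within_mono H Set.subset_union_left)).trans ?_⟩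
    exact (show (within H (A ∪ Set.range e')).Adj (e r) (e' r) from
      ⟨(h.cross _ (h.mem r hr) r).2 ⟨rfl, hr⟩, Or.inl (h.mem r hr), Or.inr ⟨r, rfl⟩⟩).reachable
  · exact ⟨r, Reachable.refl _⟩

/-- The connectivity part of a continuation, when the column is the last one of a part that is in
state `s'`. -/
theorem open_paths_and_next (h : IsColumnStep H A e s V e') {s' : State m}
    (hs' : IsCap H (A ∪ Set.range e') e' s') :
    (∀ r, ∃ r', s'.HasEdge r' ∧ (s.links ⊔ V).Reachable r r') ∧
      ∀ r, s'.HasEdge r → (s.links ⊔ V).Reachable r (s'.1 r) := by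
  refine ⟨fun r => ?_, fun r hr => (h.reachable_iff _ _).1 (hs'.linked r hr)⟩
  obtain ⟨r', h1, h2⟩ := hs'.reach (e' r) (Or.inr ⟨r, rfl⟩)
  exact ⟨r', h1, (h.reachable_iff _ _).1 h2⟩

/-- The graph that ends with the column is connected exactly when the links and the vertical edges
connect the column. -/
theorem connected_iff (h : IsColumnStep H A e s V e') (hA : A ∪ Set.range e' = Set.univ)
    [Nonempty (Fin m)] : H.Connected ↔ (s.links ⊔ V).Connected := by
  have hr := h.reachable_iff
  have hx := fun v => h.exists_reachable (v := v)
  rw [hA, within_univ] at hr hx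
  constructor
  · intro hc
    exact { preconnected := fun r r' => (hr r r').1 (hc _ _), nonempty := inferInstance }
  · intro hc
    refine { preconnected := fun u v => ?_, nonempty := ⟨e' (Classical.arbitrary _)⟩ }
    obtain ⟨a, ha⟩ := hx u trivial
    obtain ⟨b, hb⟩ := hx v trivial
    exact (ha.trans ((hr a b).2 (hc a b))).trans hb.symm

end IsColumnStep

/-- Two parts of `H` that are in states `s` and `t` and are joined along their horizontal edges
form a connected graph exactly when the states close to a single cycle. -/
theorem IsCap.connected_iff_closes {H : SimpleGraph W} {A B : Set W} {e e' : Fin m → W}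
    {s t : State m} (hs : IsCap H A e s) (ht : IsCap H B e' t) (hd : Disjoint A B)
    (hAB : A ∪ B = Set.univ) (hst : ∀ r, s.HasEdge r ↔ t.HasEdge r) (hA : A.Nonempty)
    (hmem : ∀ r, s.HasEdge r → e r ∈ A) (hmem' : ∀ r, s.HasEdge r → e' r ∈ B)
    (cross : ∀ u ∈ A, ∀ v ∈ B, H.Adj u v ↔ ∃ r, s.HasEdge r ∧ u = e r ∧ v = e' r) :
    H.Connected ↔ s.Closes t := by
  classical
  constructor
  · intro hc
    obtain ⟨v₀, hv₀⟩ := hA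
    obtain ⟨r₀, hr₀, -⟩ := hs.reach v₀ hv₀
    refine ⟨hst, ⟨r₀, hr₀⟩, fun r r' hr hr' => ?_⟩
    have hB : ∀ v, v ∉ A → v ∈ B := fun v hv =>
      ((hAB ▸ Set.mem_univ v : v ∈ A ∪ B)).resolve_left hv
    -- every node is labelled by a row whose edge it is connected to on its own side
    let f : W → Fin m := fun v =>
      if hv : v ∈ A then (hs.reach v hv).choose else (ht.reach v (hB v hv)).choose
    have fA : ∀ v ∈ A, s.HasEdge (f v) ∧ (within H A).Reachable v (e (f v)) := fun v hv => by
      simp only [f, dif_pos hv]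
      exact (hs.reach v hv).choose_spec
    have fB : ∀ v ∈ B, t.HasEdge (f v) ∧ (within H B).Reachable v (e' (f v)) := fun v hv => by
      have hv' : v ∉ A := fun h => Set.disjoint_left.1 hd h hv
      simp only [f, dif_neg hv']
      exact (ht.reach v (hB v hv')).choose_spec
    have hcross : ∀ u ∈ A, ∀ v ∈ B, H.Adj u v → (s.links ⊔ t.links).Reachable (f u) (f v) := by
      intro u hu v hv huv
      obtain ⟨x, hx, rfl, rfl⟩ := (cross u hu v hv).1 huv
      exact (hs.reachable_links le_sup_left (fA _ hu).1 hx (fA _ hu).2.symm).trans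
        (ht.reachable_links le_sup_right ((hst x).1 hx) (fB _ hv).1 (fB _ hv).2)
    have fe : ∀ r, s.HasEdge r → (s.links ⊔ t.links).Reachable (f (e r)) r := fun r hr =>
      hs.reachable_links le_sup_left (fA _ (hmem r hr)).1 hr (fA _ (hmem r hr)).2.symm
    refine ((fe r hr).symm.trans (reachable_map f (fun u v huv => ?_) (hc (e r) (e r')))).trans
      (fe r' hr')
    by_cases hu : u ∈ A <;> by_cases hv : v ∈ A
    · refine hs.reachable_links le_sup_left (fA u hu).1 (fA v hv).1 ?_
      exact ((fA u hu).2.symm.trans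
        (show (within H A).Adj u v from ⟨huv, hu, hv⟩).reachable).trans (fA v hv).2
    · exact hcross u hu v (hB v hv) huv
    · exact (hcross v hv u (hB u hu) huv.symm).symm
    · have hu := hB u hu
      have hv := hB v hv
      refine ht.reachable_links le_sup_right (fB u hu).1 (fB v hv).1 ?_
      exact ((fB u hu).2.symm.trans
        (show (within H B).Adj u v from ⟨huv, hu, hv⟩).reachable).trans (fB v hv).2
  · rintro ⟨-, -, hcl⟩
    have hle : ∀ (A : Set W) {u v}, (within H A).Reachable u v → H.Reachable u v :=
      fun A u v h =>
      h.mono (show within H A ≤ H from fun _ _ h => h.1)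
    have hee : ∀ r, s.HasEdge r → H.Reachable (e r) (e' r) := fun r hr =>
      ((cross _ (hmem r hr) _ (hmem' r hr)).2 ⟨r, hr, rfl, rfl⟩).reachable
    have hx : ∀ v, ∃ r, s.HasEdge r ∧ H.Reachable v (e r) := fun v => by
      rcases (hAB ▸ Set.mem_univ v : v ∈ A ∪ B) with hv | hv
      · obtain ⟨r, hr, h⟩ := hs.reach v hv
        exact ⟨r, hr, hle _ h⟩
      · obtain ⟨r, hr, h⟩ := ht.reach v hv
        have hr := (hst r).2 hr
        exact ⟨r, hr, (hle _ h).trans (hee r hr).symm⟩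
    refine { preconnected := fun u v => ?_, nonempty := hA.to_type }
    obtain ⟨a, ha, hua⟩ := hx u
    obtain ⟨b, hb, hvb⟩ := hx v
    refine (hua.trans (reachable_map e (fun x y hxy => ?_) (hcl a b ha hb))).trans hvb.symm
    rcases hxy with ⟨hne, rfl⟩ | ⟨hne, rfl⟩
    · exact hle _ (hs.linked x fun h => hne h.symm)
    · have hx : t.HasEdge x := fun h => hne h.symm
      exact ((hee x ((hst x).2 hx)).trans (hle _ (ht.linked x hx))).trans
        (hee _ ((hst _).2 hx.apply)).symm

/-- The part `A` of `H` is left exactly through the nodes `e r` with `P r`, by one edge each. -/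
structure IsBoundary (H : SimpleGraph W) (A : Set W) (e : Fin m → W) (P : Fin m → Prop) :
    Prop where
  inj : Function.Injective e
  mem : ∀ r, P r → e r ∈ A
  exit : ∀ r, P r → ∃! w, H.Adj (e r) w ∧ w ∉ A
  only : ∀ v ∈ A, ∀ w ∉ A, H.Adj v w → ∃ r, P r ∧ v = e r

namespace IsBoundary

variable {H : SimpleGraph W} {A : Set W} {e : Fin m → W} {P : Fin m → Prop}

theorem ncard_le_two [Finite W] (h2 : IsTwoRegular H) (v : W) :
    ((within H A).neighborSet v).ncard ≤ 2 := by
  rw [← h2 v]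
  exact Set.ncard_le_ncard (fun w hw => hw.1) (Set.toFinite _)

theorem ncard_eq_one [Finite W] (h : IsBoundary H A e P) (h2 : IsTwoRegular H) {r : Fin m}
    (hr : P r) : ((within H A).neighborSet (e r)).ncard = 1 := by
  obtain ⟨w, ⟨hw, hwA⟩, huniq⟩ := h.exit r hr
  have : (within H A).neighborSet (e r) = H.neighborSet (e r) \ {w} := by
    ext x
    constructor
    · rintro ⟨hx, -, hxA⟩
      exact ⟨hx, fun hxw => hwA (hxw ▸ hxA)⟩
    · rintro ⟨hx, hxw⟩
      refine ⟨hx, h.mem r hr, ?_⟩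
      by_contra hxA
      exact hxw (huniq x ⟨hx, hxA⟩)
  rw [this, Set.ncard_sdiff_singleton_of_mem (show w ∈ H.neighborSet (e r) from hw), h2]

theorem eq_of_ncard_eq_one [Finite W] (h : IsBoundary H A e P) (h2 : IsTwoRegular H) {v : W}
    (hv : ((within H A).neighborSet v).ncard = 1) : ∃ r, P r ∧ v = e r := by
  obtain ⟨w, hw⟩ := Set.nonempty_of_ncard_ne_zero (by rw [hv]; exact one_ne_zero)
  by_contra hne
  have : (within H A).neighborSet v = H.neighborSet v := by
    ext x
    refine ⟨fun hx => hx.1, fun hx => ⟨hx, hw.2.1, ?_⟩⟩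
    by_contra hxA
    exact hne (h.only v hw.2.1 x hxA hx)
  rw [this, h2] at hv
  omega

/-- Among three boundary nodes of one component, two coincide. -/
theorem sep [Finite W] (h : IsBoundary H A e P) (h2 : IsTwoRegular H) {a b c : Fin m}
    (ha : P a) (hb : P b) (hc : P c) (hab : b ≠ a) (rab : (within H A).Reachable (e a) (e b))
    (rac : (within H A).Reachable (e a) (e c)) : c = a ∨ c = b := by
  by_contra! hne
  exact false_of_three_ends (ncard_le_two h2) (h.inj.ne hab.symm) (h.inj.ne hne.1.symm)
    (h.inj.ne hne.2.symm) (h.ncard_eq_one h2 ha).le (h.ncard_eq_one h2 hb).le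
    (h.ncard_eq_one h2 hc).le rab rac

/-- In a 2-regular graph, the condition that a path has no further ends is automatic. -/
theorem isCap [Finite W] (h : IsBoundary H A e P) (h2 : IsTwoRegular H) {s : State m}
    (hs : ∀ r, s.HasEdge r ↔ P r)
    (reach : ∀ v ∈ A, ∃ r, s.HasEdge r ∧ (within H A).Reachable v (e r))
    (linked : ∀ r, s.HasEdge r → (within H A).Reachable (e r) (e (s.1 r))) : IsCap H A e s :=
  ⟨reach, linked, fun r r' hr hr' hrr =>
    h.sep h2 ((hs r).1 hr) ((hs _).1 hr.apply) ((hs r').1 hr') hr (linked r hr) hrr⟩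

/-- A part of a connected 2-regular graph that does not exhaust the graph has a state. -/
theorem exists_isCap [Finite W] (h : IsBoundary H A e P) (h2 : IsTwoRegular H) (hc : H.Connected)
    (hA : ∃ w, w ∉ A) : ∃ s : State m, (∀ r, s.HasEdge r ↔ P r) ∧ IsCap H A e s := by
  classical
  have hpartner : ∀ r, P r → ∃ r', r' ≠ r ∧ P r' ∧ (within H A).Reachable (e r) (e r') := by
    intro r hr
    obtain ⟨w, hw, hw1, hrw⟩ :=
      exists_ne_reachable_of_ncard_neighborSet_eq_one (ncard_le_two h2) (h.ncard_eq_one h2 hr)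
    obtain ⟨r', hr', rfl⟩ := h.eq_of_ncard_eq_one h2 hw1
    exact ⟨r', fun h => hw (h ▸ rfl), hr', hrw⟩
  choose! p hp using hpartner
  let s : State m := ⟨fun r => if P r then p r else r, fun r => by
    by_cases hr : P r
    · obtain ⟨h1, h2', h3⟩ := hp r hr
      obtain ⟨h4, h5, h6⟩ := hp _ h2'
      simp only [if_pos hr, if_pos h2']
      exact ((h.sep h2 hr h2' h5 h1 h3 (h3.trans h6)).resolve_right h4)
    · simp [if_neg hr]⟩
  have hsr : ∀ r, P r → s.1 r = p r := fun r hr => if_pos hr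
  have hs : ∀ r, s.HasEdge r ↔ P r := fun r => by
    by_cases hr : P r
    · simp only [State.HasEdge, hsr r hr, hr, iff_true]; exact (hp r hr).1
    · simp only [State.HasEdge, hr, iff_false, not_not]; exact if_neg hr
  refine ⟨s, hs, h.isCap h2 hs (fun v hv => ?_) fun r hr => ?_⟩
  · obtain ⟨w, hw⟩ := hA
    -- follow a walk from `v` to a node outside until it leaves `A`
    obtain ⟨q⟩ := hc v w
    induction q with
    | nil => exact absurd hv hw
    | @cons a b _ hab _ ih =>
      by_cases hb : b ∈ A
      · obtain ⟨r, hr, hbr⟩ := ih hb hw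
        exact ⟨r, hr, (show (within H A).Adj a b from ⟨hab, hv, hb⟩).reachable.trans hbr⟩
      · obtain ⟨r, hr, rfl⟩ := h.only _ hv _ hb hab
        exact ⟨r, (hs r).2 hr, Reachable.refl _⟩
  · have := (hs r).1 hr
    rw [hsr r this]
    exact (hp r this).2.2

end IsBoundary

end Caps

/-! ### Columns and cuts of the grid -/

section Grid

variable {m : ℕ}

theorem grid_adj {u v : Fin m × Fin m} : (grid m).Adj u v ↔
    ((u.1.val + 1 = v.1.val ∨ v.1.val + 1 = u.1.val) ∧ u.2 = v.2) ∨
      ((u.2.val + 1 = v.2.val ∨ v.2.val + 1 = u.2.val) ∧ u.1 = v.1) := by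
  rw [grid, boxProd_adj, pathGraph_adj, pathGraph_adj]

open Classical in
/-- The number 1 or 0, according to whether `p` holds. -/
noncomputable def ind (p : Prop) : ℕ := if p then 1 else 0

theorem State.deg_eq_ind (s : State m) (r : Fin m) : s.deg r = ind (s.HasEdge r) := rfl

theorem ncard_setOf_and_eq {W : Type*} (p : Prop) (w : W) : {x | p ∧ x = w}.ncard = ind p := by
  by_cases h : p <;> simp [h, ind]

/-- The vertical edges of a column are determined by the numbers of them at the nodes. -/
theorem eq_of_le_pathGraph {V V' : SimpleGraph (Fin m)} (hV : V ≤ pathGraph m)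
    (hV' : V' ≤ pathGraph m) (h : ∀ r, (V.neighborSet r).ncard = (V'.neighborSet r).ncard) :
    V = V' := by
  have key : ∀ (V V' : SimpleGraph (Fin m)), V' ≤ pathGraph m →
      (∀ r, (V.neighborSet r).ncard = (V'.neighborSet r).ncard) → ∀ k,
      (∀ r r' : Fin m, r'.val < k → r'.val + 1 = r.val → (V.Adj r' r ↔ V'.Adj r' r)) →
      ∀ r r' : Fin m, r.val = k → r.val + 1 = r'.val → V.Adj r r' → V'.Adj r r' := by
    intro V V' hV' h k ih r r' hr hr' hadj
    by_contra hne
    refine (Set.ncard_lt_ncard (s := V'.neighborSet r) (t := V.neighborSet r) ?_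
      (Set.toFinite _)).ne (h r).symm
    refine ⟨fun x hx => ?_, fun hsub => hne (hsub hadj)⟩
    rcases pathGraph_adj.1 (hV' hx) with h1 | h1
    · exact absurd (show V'.Adj r r' from (Fin.ext (hr' ▸ h1.symm) : x = r') ▸ hx) hne
    · exact ((ih r x (by omega) h1).2 hx.symm).symm
  have main : ∀ k, ∀ r r' : Fin m, r.val = k → r.val + 1 = r'.val →
      (V.Adj r r' ↔ V'.Adj r r') := by
    intro k
    induction k using Nat.strong_induction_on with
    | _ k ih =>
      intro r r' hr hr'
      exact ⟨key V V' hV' h k (fun a b hb hab => ih _ hb b a rfl hab) r r' hr hr',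
        key V' V hV (fun r => (h r).symm) k (fun a b hb hab => (ih _ hb b a rfl hab).symm)
          r r' hr hr'⟩
  ext a b
  constructor
  · intro hab
    rcases pathGraph_adj.1 (hV hab) with h1 | h1
    · exact (main _ a b rfl h1).1 hab
    · exact ((main _ b a rfl h1).1 hab.symm).symm
  · intro hab
    rcases pathGraph_adj.1 (hV' hab) with h1 | h1
    · exact (main _ a b rfl h1).2 hab
    · exact ((main _ b a rfl h1).2 hab.symm).symm

theorem State.not_hasEdge_empty (r : Fin m) : ¬ (State.empty m).HasEdge r := fun h => h rfl

variable (m) in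
/-- The nodes in the first `c` columns, to the left of cut number `c`. -/
def cols (c : ℕ) : Set (Fin m × Fin m) := {v | v.2.val < c}

theorem cols_eq_univ : cols m m = Set.univ := Set.eq_univ_of_forall fun v => v.2.2

/-- The graph with horizontal edges in the rows `h c` across cut number `c`, and with vertical
edges `V c` in column number `c`. -/
def build (h : ℕ → Fin m → Prop) (V : ℕ → SimpleGraph (Fin m)) :
    SimpleGraph (Fin m × Fin m) where
  Adj u v := (u.1 = v.1 ∧ (u.2.val + 1 = v.2.val ∧ h v.2.val u.1 ∨
      v.2.val + 1 = u.2.val ∧ h u.2.val u.1)) ∨ (u.2 = v.2 ∧ (V u.2.val).Adj u.1 v.1)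
  symm := ⟨by
    rintro ⟨a, b⟩ ⟨a', b'⟩ (⟨h1, h2⟩ | ⟨h1, h2⟩)
    · obtain rfl : a = a' := h1
      exact Or.inl ⟨rfl, h2.symm⟩
    · obtain rfl : b = b' := h1
      exact Or.inr ⟨rfl, h2.symm⟩⟩
  loopless := ⟨by
    rintro ⟨a, b⟩ (⟨-, ⟨h, -⟩ | ⟨h, -⟩⟩ | ⟨-, h⟩)
    · omega
    · omega
    · exact (V _).loopless.irrefl _ h⟩

theorem build_le_grid {h : ℕ → Fin m → Prop} {V : ℕ → SimpleGraph (Fin m)}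
    (hV : ∀ c, c < m → V c ≤ pathGraph m) : build h V ≤ grid m := by
  rintro u v (⟨h1, h2⟩ | ⟨h1, h2⟩)
  · rw [grid_adj]
    exact Or.inr ⟨h2.imp And.left And.left, h1⟩
  · rw [grid_adj]
    exact Or.inl ⟨pathGraph_adj.1 (hV _ u.2.2 h2), h1⟩

variable [NeZero m]

variable (m) in
/-- Column number `c`, counted from 0 on; only used for `c < m`. -/
def col (c : ℕ) : Fin m := Fin.ofNat m c

theorem val_col {c : ℕ} (hc : c < m) : (col m c).val = c := Nat.mod_eq_of_lt hc

theorem col_val (i : Fin m) : col m i.val = i := Fin.ext (val_col i.2)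

theorem eq_col {i : Fin m} {c : ℕ} (h : i.val = c) : i = col m c := by rw [← h, col_val]

/-- The node in row `r` immediately to the left of cut number `c`; it is only used for `0 < c`. -/
def cutEnd (c : ℕ) (r : Fin m) : Fin m × Fin m := (r, col m (c - 1))

/-- There is a horizontal edge in row `r` across cut number `c`. For the cut number 0 this is
false since a node is not adjacent to itself, and for `m ≤ c` it is false by definition. -/
def hor (H : SimpleGraph (Fin m × Fin m)) (c : ℕ) (r : Fin m) : Prop :=
  c < m ∧ H.Adj (r, col m (c - 1)) (r, col m c)

/-- The vertical edges in column number `c`. -/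
def ver (H : SimpleGraph (Fin m × Fin m)) (c : ℕ) : SimpleGraph (Fin m) :=
  H.comap fun r => (r, col m c)

theorem not_hor_zero (H : SimpleGraph (Fin m × Fin m)) (r : Fin m) : ¬ hor H 0 r :=
  fun h => H.loopless.irrefl _ h.2

variable {H H' : SimpleGraph (Fin m × Fin m)} {c : ℕ} {s s' : State m}

theorem ver_le_pathGraph (hH : H ≤ grid m) (c : ℕ) : ver H c ≤ pathGraph m := by
  intro r r' h
  rw [pathGraph_adj]
  rcases grid_adj.1 (hH (show H.Adj (r, col m c) (r', col m c) from h)) with ⟨h, -⟩ | ⟨h, -⟩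
  · exact h
  · simp at h

/-- The edges at a node are those to the left, in the column, and to the right. -/
theorem ncard_neighborSet (hH : H ≤ grid m) (hc : c < m) (r : Fin m) :
    (H.neighborSet (r, col m c)).ncard =
      ind (hor H c r) + ((ver H c).neighborSet r).ncard + ind (hor H (c + 1) r) := by
  set L : Set (Fin m × Fin m) := {x | hor H c r ∧ x = (r, col m (c - 1))} with hL
  set M : Set (Fin m × Fin m) := (fun r' => (r', col m c)) '' (ver H c).neighborSet r with hM
  set R : Set (Fin m × Fin m) := {x | hor H (c + 1) r ∧ x = (r, col m (c + 1))} with hR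
  have hLx : ∀ x ∈ L, 0 < c ∧ x.2.val = c - 1 := by
    rintro x ⟨h, rfl⟩
    rcases Nat.eq_zero_or_pos c with rfl | h0
    · exact absurd h (not_hor_zero H r)
    · exact ⟨h0, val_col (by omega)⟩
  have hMx : ∀ x ∈ M, x.2.val = c := by
    rintro _ ⟨x, -, rfl⟩
    exact val_col hc
  have hRx : ∀ x ∈ R, x.2.val = c + 1 := by
    rintro x ⟨h, rfl⟩
    exact val_col h.1
  have hunion : H.neighborSet (r, col m c) = L ∪ M ∪ R := by
    ext ⟨a, b⟩
    constructor
    · intro h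
      rcases grid_adj.1 (hH h) with ⟨-, h2⟩ | ⟨h1 | h1, h2⟩
      · obtain rfl : col m c = b := h2
        exact Or.inl (Or.inr ⟨a, h, rfl⟩)
      · obtain rfl : r = a := h2
        simp only [val_col hc] at h1
        obtain rfl := eq_col h1.symm
        exact Or.inr ⟨⟨by have := (col m (c + 1)).2; omega, h⟩, rfl⟩
      · obtain rfl : r = a := h2
        simp only [val_col hc] at h1
        obtain rfl : b = col m (c - 1) := eq_col (by omega)
        exact Or.inl (Or.inl ⟨⟨hc, h.symm⟩, rfl⟩)
    · rintro ((⟨h, h'⟩ | ⟨x, hx, h'⟩) | ⟨h, h'⟩)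
      · exact h' ▸ h.2.symm
      · exact h' ▸ hx
      · exact h' ▸ h.2
  rw [hunion, Set.ncard_union_eq _ (Set.toFinite _) (Set.toFinite _),
    Set.ncard_union_eq _ (Set.toFinite _) (Set.toFinite _), hL, hM, hR, ncard_setOf_and_eq,
    ncard_setOf_and_eq, Set.ncard_image_of_injective]
  · exact fun a b h => congrArg Prod.fst h
  · rw [Set.disjoint_left]
    intro x h1 h2
    have := hLx x h1
    have := hMx x h2
    omega
  · rw [Set.disjoint_left]
    intro x h1 h2
    have := hRx x h2
    rcases h1 with h1 | h1
    · have := hLx x h1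
      omega
    · have := hMx x h1
      omega

/-- A 2-regular subgraph of the grid is determined by its horizontal edges. -/
theorem eq_of_hor_iff (hH : H ≤ grid m) (hH' : H' ≤ grid m) (h2 : IsTwoRegular H)
    (h2' : IsTwoRegular H') (h : ∀ c, 0 < c → c < m → ∀ r, hor H c r ↔ hor H' c r) : H = H' := by
  have hh : ∀ c r, hor H c r ↔ hor H' c r := fun c r => by
    rcases Nat.eq_zero_or_pos c with rfl | h0
    · exact iff_of_false (not_hor_zero H r) (not_hor_zero H' r)
    · by_cases hc : c < m
      · exact h c h0 hc r
      · exact iff_of_false (fun h => hc h.1) (fun h => hc h.1)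
  have hv : ∀ c, c < m → ver H c = ver H' c := fun c hc =>
    eq_of_le_pathGraph (ver_le_pathGraph hH c) (ver_le_pathGraph hH' c) fun r => by
      have e1 := ncard_neighborSet hH hc r
      have e2 := ncard_neighborSet hH' hc r
      rw [h2] at e1
      rw [h2', ← hh, ← hh] at e2
      omega
  have key : ∀ H H' : SimpleGraph (Fin m × Fin m), H ≤ grid m → (∀ c r, hor H c r ↔ hor H' c r) →
      (∀ c, c < m → ver H c = ver H' c) → H ≤ H' := by
    rintro H H' hH hh hv ⟨a, b⟩ ⟨a', b'⟩ hadj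
    have aux : ∀ (a b b' : Fin m), b.val + 1 = b'.val → H.Adj (a, b) (a, b') →
        H'.Adj (a, b) (a, b') := by
      intro a b b' hb hadj
      have e1 : b = col m (b'.val - 1) := eq_col (by omega)
      have e2 : b' = col m b'.val := (col_val b').symm
      have := (hh b'.val a).1 ⟨b'.2, by rwa [← e1, ← e2]⟩
      rw [e1, e2, val_col b'.2]
      exact this.2
    rcases grid_adj.1 (hH hadj) with ⟨-, h1⟩ | ⟨h1 | h1, h3⟩
    · obtain rfl : b = b' := h1
      have : (ver H b.val).Adj a a' := by rwa [ver, comap_adj, col_val]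
      rwa [hv _ b.2, ver, comap_adj, col_val] at this
    · obtain rfl : a = a' := h3
      exact aux a b b' h1 hadj
    · obtain rfl : a = a' := h3
      exact (aux a b' b h1 hadj.symm).symm
  exact le_antisymm (key H H' hH hh hv)
    (key H' H hH' (fun c r => (hh c r).symm) fun c hc => (hv c hc).symm)

/-! ### The states of a subgraph of the grid -/

/-- `s` is the state of `H` at cut number `c`. -/
structure AtCut (H : SimpleGraph (Fin m × Fin m)) (c : ℕ) (s : State m) : Prop where
  edges : ∀ r, s.HasEdge r ↔ hor H c r
  cap : IsCap H (cols m c) (cutEnd c) s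

theorem AtCut.eq (h : AtCut H c s) (h' : AtCut H c s') : s = s' :=
  h.cap.eq h'.cap fun r => (h.edges r).trans (h'.edges r).symm

theorem atCut_zero (H : SimpleGraph (Fin m × Fin m)) : AtCut H 0 (State.empty m) where
  edges r := iff_of_false (State.not_hasEdge_empty r) (not_hor_zero H r)
  cap :=
    { reach := fun _ hv => absurd hv (Nat.not_lt_zero _)
      linked := fun r h => absurd h (State.not_hasEdge_empty r)
      sep := fun r _ h => absurd h (State.not_hasEdge_empty r) }

theorem pos_of_hor {r : Fin m} (h : hor H c r) : 0 < c := by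
  rcases Nat.eq_zero_or_pos c with rfl | h0
  · exact absurd h (not_hor_zero H r)
  · exact h0

theorem cutEnd_mem_cols (hc : 0 < c) (hm : c ≤ m) (r : Fin m) : cutEnd c r ∈ cols m c := by
  change (col m (c - 1)).val < c
  rw [val_col (by omega)]
  omega

theorem mem_cols_of_hor {r : Fin m} (h : hor H c r) : cutEnd c r ∈ cols m c :=
  cutEnd_mem_cols (pos_of_hor h) h.1.le r

theorem cutEnd_injective (c : ℕ) : Function.Injective (cutEnd (m := m) c) :=
  fun _ _ h => congrArg Prod.fst h

/-- An edge that crosses a cut is a horizontal edge at it. -/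
theorem adj_across_iff (hH : H ≤ grid m) {u v : Fin m × Fin m} (hu : u ∈ cols m c)
    (hv : v ∉ cols m c) : H.Adj u v ↔ ∃ r, hor H c r ∧ u = cutEnd c r ∧ v = (r, col m c) := by
  obtain ⟨a, b⟩ := u
  obtain ⟨a', b'⟩ := v
  have hu : b.val < c := hu
  have hv : ¬ b'.val < c := hv
  constructor
  · intro hadj
    rcases grid_adj.1 (hH hadj) with ⟨-, h1⟩ | ⟨h1 | h1, h3⟩
    · obtain rfl : b = b' := h1
      omega
    · obtain rfl : a = a' := h3
      simp only at h1
      obtain rfl : b' = col m c := eq_col (by omega)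
      obtain rfl : b = col m (c - 1) := eq_col (by omega)
      exact ⟨a, ⟨by have := (col m c).2; omega, hadj⟩, rfl, rfl⟩
    · simp only at h1
      omega
  · rintro ⟨r, h, e1, e2⟩
    rw [e1, e2]
    exact h.2

theorem isBoundary_cols (hH : H ≤ grid m) (c : ℕ) :
    IsBoundary H (cols m c) (cutEnd c) (hor H c) where
  inj := cutEnd_injective c
  mem r h := mem_cols_of_hor h
  exit r h := by
    refine ⟨(r, col m c), ⟨h.2, fun hx => ?_⟩, ?_⟩
    · have : (col m c).val < c := hx
      rw [val_col h.1] at this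
      omega
    · rintro w ⟨hw, hwc⟩
      obtain ⟨r', -, e1, e2⟩ := (adj_across_iff hH (mem_cols_of_hor h) hwc).1 hw
      rw [e2, cutEnd_injective c e1]
  only v hv w hw hvw := by
    obtain ⟨r, h, e, -⟩ := (adj_across_iff hH hv hw).1 hvw
    exact ⟨r, h, e⟩

theorem exists_atCut (hH : H ≤ grid m) (h2 : IsTwoRegular H) (hconn : H.Connected) (hc : c < m) :
    ∃ s, AtCut H c s := by
  obtain ⟨s, h1, h2⟩ := (isBoundary_cols hH c).exists_isCap h2 hconn
    ⟨(0, col m c), fun h => by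
      have : (col m c).val < c := h
      rw [val_col hc] at this
      omega⟩
  exact ⟨s, h1, h2⟩

theorem cols_succ (hc : c < m) :
    cols m c ∪ Set.range (cutEnd (m := m) (c + 1)) = cols m (c + 1) := by
  ext ⟨a, b⟩
  constructor
  · rintro (h | ⟨r, h⟩)
    · exact Nat.lt_succ_of_lt h
    · rw [← h]; exact cutEnd_mem_cols (Nat.succ_pos c) hc r
  · intro h
    rcases Nat.lt_succ_iff_lt_or_eq.1 (show b.val < c + 1 from h) with h | h
    · exact Or.inl h
    · exact Or.inr ⟨a, by rw [eq_col h]; rfl⟩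

theorem AtCut.isColumnStep (h : AtCut H c s) (hH : H ≤ grid m) (hc : c < m) :
    IsColumnStep H (cols m c) (cutEnd c) s (ver H c) (cutEnd (c + 1)) where
  cap := h.cap
  mem r hr := mem_cols_of_hor ((h.edges r).1 hr)
  inj := cutEnd_injective _
  notMem r hr := by
    have : (col m c).val < c := hr
    rw [val_col hc] at this
    omega
  adj r r' := Iff.rfl
  cross u hu r := by
    have hn : cutEnd (c + 1) r ∉ cols m c := fun hr => by
      have : (col m c).val < c := hr
      rw [val_col hc] at this
      omega
    rw [adj_across_iff hH hu hn]
    constructor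
    · rintro ⟨r', h1, h3, h4⟩
      obtain rfl : r = r' := congrArg Prod.fst h4
      exact ⟨h3, (h.edges r).2 h1⟩
    · rintro ⟨h1, h3⟩
      exact ⟨r, (h.edges r).1 h3, h1, rfl⟩

theorem AtCut.deg_eq (h : AtCut H c s) (r : Fin m) : s.deg r = ind (hor H c r) := by
  rw [State.deg_eq_ind, propext (h.edges r)]

/-- The states at two consecutive cuts are related by a continuation. -/
theorem AtCut.isContinuation (h : AtCut H c s) (h' : AtCut H (c + 1) s') (hH : H ≤ grid m)
    (h2 : IsTwoRegular H) (hc : c < m) : State.IsContinuation s (ver H c) s' := by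
  have hstep := h.isColumnStep hH hc
  have hcap := h'.cap
  rw [← cols_succ hc] at hcap
  obtain ⟨h3, h4⟩ := hstep.open_paths_and_next hcap
  exact ⟨ver_le_pathGraph hH c, fun r => by
    rw [h.deg_eq, h'.deg_eq, ← ncard_neighborSet hH hc, h2], h3, h4⟩

/-- A continuation of the state at a cut is the state at the next cut. -/
theorem AtCut.succ (h : AtCut H c s) (hs : State.IsContinuation s (ver H c) s')
    (hedge : ∀ r, s'.HasEdge r ↔ hor H (c + 1) r) (hH : H ≤ grid m) (h2 : IsTwoRegular H)
    (hc : c < m) : AtCut H (c + 1) s' := by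
  have hstep := h.isColumnStep hH hc
  refine ⟨hedge, (isBoundary_cols hH (c + 1)).isCap h2 hedge (fun v hv => ?_) fun r hr => ?_⟩
  · rw [← cols_succ hc] at hv ⊢
    obtain ⟨r, hr⟩ := hstep.exists_reachable hv
    obtain ⟨r', h1, h3⟩ := hs.open_paths r
    exact ⟨r', h1, hr.trans ((hstep.reachable_iff r r').2 h3)⟩
  · rw [← cols_succ hc]
    exact (hstep.reachable_iff _ _).2 (hs.next r hr)

/-- At the last cut, the graph is connected exactly when the last column closes the cycle. -/
theorem AtCut.connected_iff (h : AtCut H c s) (hH : H ≤ grid m) (hc : c + 1 = m) :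
    H.Connected ↔ (s.links ⊔ ver H c).Connected :=
  (h.isColumnStep hH (by omega)).connected_iff
    (by rw [cols_succ (by omega), hc, cols_eq_univ])

theorem AtCut.deg_add_eq_two (h : AtCut H c s) (hH : H ≤ grid m) (h2 : IsTwoRegular H)
    (hc : c + 1 = m) (r : Fin m) : s.deg r + ((ver H c).neighborSet r).ncard = 2 := by
  have := ncard_neighborSet hH (show c < m by omega) r
  have h0 : ind (hor H (c + 1) r) = 0 := if_neg fun h => by have := h.1; omega
  rw [h2, ← h.deg_eq, h0] at this
  omega

/-! ### Graphs assembled from their columns -/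

variable {h : ℕ → Fin m → Prop} {V : ℕ → SimpleGraph (Fin m)}

theorem hor_build (hc0 : 0 < c) (hc : c < m) (r : Fin m) : hor (build h V) c r ↔ h c r := by
  have e1 := val_col (m := m) (c := c - 1) (by omega)
  have e2 := val_col hc
  have hne : col m (c - 1) ≠ col m c := fun h => by rw [Fin.ext_iff] at h; omega
  simp only [hor, build, e1, e2, hc, hne, true_and, false_and, or_false]
  constructor
  · rintro (⟨-, h⟩ | ⟨h, -⟩)
    · exact h
    · omega
  · exact fun h => Or.inl ⟨by omega, h⟩

theorem ver_build (hc : c < m) : ver (build h V) c = V c := by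
  ext r r'
  simp only [ver, build, comap_adj, val_col hc, true_and]
  constructor
  · rintro (⟨-, ⟨h, -⟩ | ⟨h, -⟩⟩ | h)
    · omega
    · omega
    · exact h
  · exact Or.inr

/-- If every node has two edges, as counted in its column and across the two adjacent cuts, then
the assembled graph is 2-regular. -/
theorem isTwoRegular_build (hV : ∀ c, c < m → V c ≤ pathGraph m) (h0 : ∀ r, ¬ h 0 r)
    (hm : ∀ r, ¬ h m r)
    (hdeg : ∀ c, c < m → ∀ r, ind (h c r) + ((V c).neighborSet r).ncard + ind (h (c + 1) r) = 2) :
    IsTwoRegular (build h V) := by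
  rintro ⟨r, b⟩
  have hh : ∀ c, c ≤ m → (hor (build h V) c r ↔ h c r) := fun c hc => by
    rcases Nat.eq_zero_or_pos c with rfl | h0'
    · exact iff_of_false (not_hor_zero _ r) (h0 r)
    · rcases hc.lt_or_eq with hc | rfl
      · exact hor_build h0' hc r
      · exact iff_of_false (fun h => absurd h.1 (lt_irrefl _)) (hm r)
  rw [← col_val b, ncard_neighborSet (build_le_grid hV) b.2, ver_build b.2, propext (hh _ b.2.le),
    propext (hh _ b.2), hdeg _ b.2]

end Grid

/-! ### Sequences of states and powers of the transfer matrix -/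

section Sequences

variable {S : Type*}

/-- A sequence that starts with `s`, makes `k` steps of the relation `R`, and ends in `b`. The
irrelevant later terms are fixed to be `d`, so that sequences can be counted. -/
structure IsSeq (d : S) (R : S → S → Prop) (b : S → Prop) (k : ℕ) (s : S) (f : ℕ → S) : Prop where
  zero : f 0 = s
  step : ∀ i, i < k → R (f i) (f (i + 1))
  last : b (f k)
  after : ∀ i, k < i → f i = d

/-- The sequence `f` with the new first term `s`. -/
def consSeq (s : S) (f : ℕ → S) : ℕ → S
  | 0 => s
  | i + 1 => f i

theorem consSeq_injective (s : S) : Function.Injective (consSeq s) :=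
  fun _ _ h => funext fun i => congrFun h (i + 1)

theorem isSeq_succ_iff {d : S} {R : S → S → Prop} {b : S → Prop} {k : ℕ} {s : S} {f : ℕ → S} :
    IsSeq d R b (k + 1) s f ↔
      ∃ s', R s s' ∧ ∃ g, IsSeq d R b k s' g ∧ consSeq s g = f := by
  constructor
  · rintro ⟨rfl, h1, h2, h3⟩
    refine ⟨f 1, h1 0 (Nat.succ_pos k), fun i => f (i + 1),
      ⟨rfl, fun i hi => h1 (i + 1) (by omega), h2, fun i hi => h3 _ (by omega)⟩, ?_⟩
    funext i
    cases i <;> rfl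
  · rintro ⟨s', h, g, ⟨rfl, h1, h2, h3⟩, rfl⟩
    refine ⟨rfl, fun i hi => ?_, h2, fun i hi => ?_⟩
    · cases i with
      | zero => exact h
      | succ i => exact h1 i (by omega)
    · cases i with
      | zero => omega
      | succ i => exact h3 i (by omega)

/-- Powers of a 0/1 matrix count sequences. -/
theorem exists_finset_isSeq [Fintype S] [DecidableEq S] (d : S) (R : S → S → Prop) (b : S → Prop)
    (M : Matrix S S ℕ) (hM : ∀ i j, M j i = ind (R i j)) (k : ℕ) (s : S) :
    ∃ F : Finset (ℕ → S), (∀ f, f ∈ F ↔ IsSeq d R b k s f) ∧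
      F.card = ((fun s => ind (b s)) ᵥ* M ^ k) s := by
  classical
  induction k generalizing s with
  | zero =>
    refine ⟨if b s then {consSeq s fun _ => d} else ∅, fun f => ?_, ?_⟩
    · have : IsSeq d R b 0 s f ↔ b s ∧ f = consSeq s fun _ => d := by
        constructor
        · rintro ⟨rfl, -, h2, h3⟩
          refine ⟨h2, funext fun i => ?_⟩
          cases i with
          | zero => rfl
          | succ i => exact h3 _ (Nat.succ_pos i)
        · rintro ⟨h, rfl⟩
          refine ⟨rfl, fun i hi => absurd hi (Nat.not_lt_zero i), h, fun i hi => ?_⟩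
          cases i with
          | zero => omega
          | succ i => rfl
      rw [this]
      split_ifs with h <;> simp [h]
    · rw [pow_zero, Matrix.vecMul_one, ind]
      split_ifs <;> simp
  | succ k ih =>
    choose F hF hcard using ih
    refine ⟨(Finset.univ.filter (R s)).biUnion fun s' => (F s').image (consSeq s),
      fun f => ?_, ?_⟩
    · rw [isSeq_succ_iff]
      simp [hF]
    · rw [Finset.card_biUnion, pow_succ, ← Matrix.vecMul_vecMul, Matrix.vecMul, dotProduct,
        Finset.sum_filter]
      · refine Finset.sum_congr rfl fun s' _ => ?_
        rw [Finset.card_image_of_injective _ (consSeq_injective s), hcard, hM, ind]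
        split_ifs <;> simp
      · intro a _ a' _ hne
        rw [Function.onFun, Finset.disjoint_left]
        intro f hf hf'
        obtain ⟨g, hg, rfl⟩ := Finset.mem_image.1 hf
        obtain ⟨g', hg', he⟩ := Finset.mem_image.1 hf'
        obtain rfl := consSeq_injective s he
        exact hne (((hF _ _).1 hg).zero.symm.trans ((hF _ _).1 hg').zero)

/-- The number of sequences of `k + 1` steps that start with `d` and end in `b`. The first step is
absorbed in the vector `α`, just as the leftmost column of the grid, which continues the empty state,
is absorbed in the starting states. -/
theorem ncard_isSeq [Fintype S] [DecidableEq S] (d : S) (R : S → S → Prop) (b : S → Prop)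
    (M : Matrix S S ℕ) (hM : ∀ i j, M j i = ind (R i j)) (α β : S → ℕ)
    (hα : ∀ s, α s = ind (R d s)) (hβ : ∀ s, β s = ind (b s)) (k : ℕ) :
    {f | IsSeq d R b (k + 1) d f}.ncard = β ⬝ᵥ ((M ^ k) *ᵥ α) := by
  obtain ⟨F, hF, hcard⟩ := exists_finset_isSeq d R b M hM (k + 1) d
  have : {f | IsSeq d R b (k + 1) d f} = ↑F := by ext f; simp [hF]
  rw [this, Set.ncard_coe_finset, hcard, Matrix.dotProduct_mulVec, funext hβ, pow_succ,
    ← Matrix.vecMul_vecMul]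
  exact Finset.sum_congr rfl fun s _ => by rw [hα, ← hM]

end Sequences

/-! ### Symmetric states and columns -/

section Symmetric

variable {m : ℕ}

/-- There is a continuation from `s` to `s'`. -/
def Continues (s s' : State m) : Prop := ∃ V, State.IsContinuation s V s'

theorem State.hasEdge_flip (s : State m) (r : Fin m) : s.flip.HasEdge r ↔ s.HasEdge r.rev := by
  rw [State.HasEdge, State.HasEdge, not_iff_not]
  exact Fin.rev_eq_iff

theorem State.IsSymmetric.deg_rev {s : State m} (hs : s.IsSymmetric) (r : Fin m) :
    s.deg r.rev = s.deg r := by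
  rw [State.deg_eq_ind, State.deg_eq_ind, ← propext (s.hasEdge_flip r), hs]

theorem ncard_neighborSet_comap {W : Type*} (H : SimpleGraph W) (τ : W ≃ W) (v : W) :
    ((H.comap τ).neighborSet v).ncard = (H.neighborSet (τ v)).ncard := by
  rw [← Set.ncard_image_of_injective _ τ.injective]
  congr 1
  ext w
  constructor
  · rintro ⟨x, hx, rfl⟩
    exact hx
  · intro hw
    obtain ⟨x, rfl⟩ := τ.surjective w
    exact ⟨x, hw, rfl⟩

theorem pathGraph_adj_rev (r r' : Fin m) :
    (pathGraph m).Adj r.rev r'.rev ↔ (pathGraph m).Adj r r' := by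
  rw [pathGraph_adj, pathGraph_adj, Fin.val_rev, Fin.val_rev]
  omega

/-- A continuation between symmetric states is symmetric, since it is determined by the numbers of
vertical edges at the nodes. -/
theorem State.IsContinuation.isSymmetricColumn {s s' : State m} {V : SimpleGraph (Fin m)}
    (h : State.IsContinuation s V s') (hs : s.IsSymmetric) (hs' : s'.IsSymmetric) :
    IsSymmetricColumn V := by
  have : V.comap Fin.revPerm = V := by
    refine eq_of_le_pathGraph (fun r r' hr => (pathGraph_adj_rev r r').1 (h.vertical hr))
      h.vertical fun r => ?_
    rw [ncard_neighborSet_comap]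
    have h1 := h.degree_two r
    have h2 := h.degree_two r.rev
    rw [hs.deg_rev, hs'.deg_rev] at h2
    change (V.neighborSet r.rev).ncard = _
    omega
  intro r r'
  conv_rhs => rw [← this]
  rfl

/-- A symmetric state is symmetric under a rotation exactly when it is under a reflection. -/
theorem State.IsSymmetric.closesByRotation_iff {s : State m} (hs : s.IsSymmetric) :
    s.ClosesByRotation ↔ s.ClosesByReflection := by
  rw [State.ClosesByRotation, State.ClosesByReflection, hs]

theorem State.isSinglePair_iff_closesByReflection (s : State m) :
    s.IsSinglePair ↔ s.ClosesByReflection := by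
  rw [State.ClosesByReflection, State.Closes, sup_idem]
  constructor
  · intro h
    obtain ⟨x, y, hxy, he⟩ := Set.ncard_eq_two.1 h
    have hmem : ∀ r, s.HasEdge r ↔ r = x ∨ r = y := fun r => Set.ext_iff.1 he r
    have hx : s.HasEdge x := (hmem x).2 (Or.inl rfl)
    have hadj : s.links.Adj x y := ⟨hxy, ((hmem _).1 hx.apply).resolve_left hx⟩
    refine ⟨fun _ => Iff.rfl, ⟨x, hx⟩, fun r r' hr hr' => ?_⟩
    rcases (hmem r).1 hr with rfl | rfl <;> rcases (hmem r').1 hr' with rfl | rfl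
    · exact Reachable.refl _
    · exact hadj.reachable
    · exact hadj.symm.reachable
    · exact Reachable.refl _
  · rintro ⟨-, ⟨r, hr⟩, h⟩
    have key : ∀ x y, s.links.Reachable x y → y = x ∨ y = s.1 x := by
      rintro x y ⟨p⟩
      induction p with
      | nil => exact Or.inl rfl
      | @cons a b c hab _ ih =>
        rcases ih with rfl | rfl
        · exact Or.inr hab.2.symm
        · exact Or.inl (by rw [← hab.2, s.2])
    refine Set.ncard_eq_two.2 ⟨r, s.1 r, fun h => hr h.symm, Set.ext fun x => ?_⟩
    exact ⟨fun hx => key r x (h r x hr hx), by rintro (rfl | rfl); exacts [hr, hr.apply]⟩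

/-- Sequences whose states happen to be symmetric are the same as sequences of symmetric states with
symmetric continuations. -/
theorem ncard_isSeq_symState (b : State m → Prop) (k : ℕ) (hd : (State.empty m).IsSymmetric) :
    {F | IsSeq (State.empty m) Continues b k (State.empty m) F ∧
        ∀ i, (F i).IsSymmetric}.ncard =
      {f : ℕ → SymState m | IsSeq ⟨State.empty m, hd⟩
        (fun s s' => ∃ V, State.IsContinuation s.1 V s'.1 ∧ IsSymmetricColumn V)
        (fun s => b s.1) k ⟨State.empty m, hd⟩ f}.ncard := by
  symm
  refine Set.ncard_congr (fun f _ i => (f i).1) ?_ ?_ ?_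
  · rintro f ⟨h0, h1, h2, h3⟩
    refine ⟨⟨congrArg Subtype.val h0, fun i hi => ?_, h2, fun i hi =>
      congrArg Subtype.val (h3 i hi)⟩, fun i => (f i).2⟩
    obtain ⟨V, hV, -⟩ := h1 i hi
    exact ⟨V, hV⟩
  · intro f g _ _ h
    exact funext fun i => Subtype.ext (congrFun h i)
  · rintro F ⟨⟨h0, h1, h2, h3⟩, hs⟩
    refine ⟨fun i => ⟨F i, hs i⟩, ⟨Subtype.ext h0, fun i hi => ?_, h2, fun i hi =>
      Subtype.ext (h3 i hi)⟩, rfl⟩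
    obtain ⟨V, hV⟩ := h1 i hi
    exact ⟨V, hV, hV.isSymmetricColumn (hs i) (hs (i + 1))⟩

theorem alpha_eq_ind (s : State m) : alpha m s = ind (Continues (State.empty m) s) := rfl

theorem T_apply (s s' : State m) : T m s' s = ind (Continues s s') := by
  rw [T, Matrix.of_apply, ind, Continues]; congr

theorem alphaBar_eq_ind (hd : (State.empty m).IsSymmetric) (s : SymState m) : alphaBar m s =
    ind (∃ V, State.IsContinuation (State.empty m) V s.1 ∧ IsSymmetricColumn V) :=
  congrArg ind (propext ⟨fun ⟨V, hV⟩ => ⟨V, hV, hV.isSymmetricColumn hd s.2⟩,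
    fun ⟨V, hV, _⟩ => ⟨V, hV⟩⟩)

theorem TBar_apply (s s' : SymState m) : TBar m s' s =
    ind (∃ V, State.IsContinuation s.1 V s'.1 ∧ IsSymmetricColumn V) := by
  rw [TBar, Matrix.of_apply, ind]; congr

end Symmetric

/-! ### Hamiltonian subgraphs and the symmetries of the square -/

section Hamiltonian

variable {m : ℕ}

/-- The graph consisting of the edges of a Hamiltonian cycle of the grid. -/
structure IsHam (H : SimpleGraph (Fin m × Fin m)) : Prop where
  le : H ≤ grid m
  two : IsTwoRegular H
  conn : H.Connected

/-- The map `τ` of the nodes preserves the graph. -/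
def Inv {W : Type*} (τ : W → W) (H : SimpleGraph W) : Prop := ∀ u v, H.Adj (τ u) (τ v) ↔ H.Adj u v

theorem invariantUnder_edgeSet_iff {f : Fin m × Fin m → Fin m × Fin m}
    (hf : Function.Involutive f) (H : SimpleGraph (Fin m × Fin m)) :
    InvariantUnder f H.edgeSet ↔ Inv f H := by
  have hff : Function.Involutive (Sym2.map f) := fun e => by
    rw [Sym2.map_map, hf.comp_self, Sym2.map_id]; rfl
  constructor
  · intro h
    have h1 : ∀ u v, H.Adj u v → H.Adj (f u) (f v) := fun u v huv => by
      have : Sym2.map f s(u, v) ∈ H.edgeSet := h ▸ Set.mem_image_of_mem _ huv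
      exact this
    exact fun u v => ⟨fun huv => by simpa only [hf u, hf v] using h1 _ _ huv, h1 u v⟩
  · intro h
    have h1 : ∀ e, Sym2.map f e ∈ H.edgeSet ↔ e ∈ H.edgeSet := fun e => by
      induction e with
      | h u v => exact h u v
    ext e
    constructor
    · rintro ⟨e, he, rfl⟩
      exact (h1 e).2 he
    · exact fun he => ⟨_, (h1 e).2 he, hff e⟩

/-- Counting Hamiltonian cycles amounts to counting connected 2-regular subgraphs. -/
theorem ncard_hamCycles {P : Set (Sym2 (Fin m × Fin m)) → Prop}
    {Q : SimpleGraph (Fin m × Fin m) → Prop} (hPQ : ∀ H, P H.edgeSet ↔ Q H) :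
    {E | E ∈ hamCycles m ∧ P E}.ncard = {H | IsHam H ∧ Q H}.ncard := by
  have : {E | E ∈ hamCycles m ∧ P E} = edgeSet '' {H | IsHam H ∧ Q H} := by
    ext E
    constructor
    · rintro ⟨hE, hP⟩
      obtain ⟨H, h1, h2, h3, rfl⟩ := (exists_isHamiltonianCycle_iff (grid m) E).1 hE
      exact ⟨H, ⟨⟨h1, h2, h3⟩, (hPQ H).1 hP⟩, rfl⟩
    · rintro ⟨H, ⟨⟨h1, h2, h3⟩, hQ⟩, rfl⟩
      exact ⟨(exists_isHamiltonianCycle_iff (grid m) _).2 ⟨H, h1, h2, h3, rfl⟩, (hPQ H).2 hQ⟩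
  rw [this, Set.ncard_image_of_injective _ edgeSet_injective]

theorem IsHam.comap {H : SimpleGraph (Fin m × Fin m)} (h : IsHam H)
    (τ : Fin m × Fin m ≃ Fin m × Fin m) (hτ : Inv τ (grid m)) : IsHam (H.comap τ) :=
  ⟨fun u v huv => (hτ u v).1 (h.le huv), fun v => by rw [ncard_neighborSet_comap, h.two],
    (Iso.comap τ H).connected_iff.2 h.conn⟩

theorem inv_swap_grid : Inv (Equiv.prodComm (Fin m) (Fin m)) (grid m) := by
  intro u v
  rw [grid_adj, grid_adj]
  exact Or.comm

theorem involutive_reflH : Function.Involutive (reflH (m := m)) := fun v => by simp [reflH]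
theorem involutive_reflV : Function.Involutive (reflV (m := m)) := fun v => by simp [reflV]
theorem involutive_rot180 : Function.Involutive (rot180 (m := m)) := fun v => by simp [rot180]

theorem inv_reflH_grid : Inv reflH (grid m) := by
  intro u v
  rw [grid_adj, grid_adj]
  simp only [reflH, Fin.val_rev, Fin.rev_inj]
  omega

/-- Transposition of the square exchanges the two reflections. -/
theorem countBV_eq_countBH : countBV m = countBH m := by
  rw [countBV, countBH, ncard_hamCycles (invariantUnder_edgeSet_iff involutive_reflV),
    ncard_hamCycles (invariantUnder_edgeSet_iff involutive_reflH)]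
  refine Set.ncard_congr (fun H _ => H.comap (Equiv.prodComm (Fin m) (Fin m))) ?_ ?_ ?_
  · rintro H ⟨h1, h2⟩
    exact ⟨h1.comap _ inv_swap_grid, fun u v => h2 u.swap v.swap⟩
  · intro H H' _ _ h
    ext u v
    exact (congrArg (fun G => G.Adj u.swap v.swap) h).to_iff
  · rintro H ⟨h1, h2⟩
    exact ⟨H.comap (Equiv.prodComm (Fin m) (Fin m)), ⟨h1.comap _ inv_swap_grid,
      fun u v => h2 u.swap v.swap⟩, rfl⟩

end Hamiltonian

/-! ### Reading off and gluing the states of a Hamiltonian cycle -/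

section Schemes

variable {m : ℕ} [NeZero m]

open Classical in
/-- The states of `H` at the cuts with numbers up to `k`, followed by empty states. -/
noncomputable def states (k : ℕ) (H : SimpleGraph (Fin m × Fin m)) (c : ℕ) : State m :=
  if h : c ≤ k ∧ ∃ s, AtCut H c s then h.2.choose else State.empty m

/-- The Hamiltonian cycles with property `C` correspond to the sequences of states up to cut
number `k` whose last term is in `b`: they are determined by the horizontal edges up to this cut,
and every such sequence comes from a cycle. -/
structure IsCutScheme (k : ℕ) (C : SimpleGraph (Fin m × Fin m) → Prop) (b : State m → Prop) :
    Prop where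
  lt : k < m
  det : ∀ H H', IsHam H → IsHam H' → C H → C H' →
    (∀ c, 0 < c → c ≤ k → ∀ r, hor H c r ↔ hor H' c r) → H = H'
  last : ∀ H, IsHam H → C H → ∀ s, AtCut H k s → b s
  exists_isHam : ∀ F, IsSeq (State.empty m) Continues b k (State.empty m) F →
    ∃ H, IsHam H ∧ C H ∧ ∀ c, c ≤ k → AtCut H c (F c)
  refl : ∀ H, C H → C (H.comap reflH)

variable {k : ℕ} {C : SimpleGraph (Fin m × Fin m) → Prop} {b : State m → Prop}
  {H : SimpleGraph (Fin m × Fin m)}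

theorem IsHam.atCut_states (h : IsHam H) (hk : k < m) {c : ℕ} (hc : c ≤ k) :
    AtCut H c (states k H c) := by
  have hx : c ≤ k ∧ ∃ s, AtCut H c s := ⟨hc, exists_atCut h.le h.two h.conn (hc.trans_lt hk)⟩
  rw [states, dif_pos hx]
  exact hx.2.choose_spec

theorem states_of_lt {c : ℕ} (hc : k < c) : states k H c = State.empty m :=
  dif_neg fun h => absurd h.1 (not_le.2 hc)

theorem IsHam.isSeq_states (h : IsHam H) (hk : k < m) (hb : ∀ s, AtCut H k s → b s) :
    IsSeq (State.empty m) Continues b k (State.empty m) (states k H) where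
  zero := (h.atCut_states hk (Nat.zero_le k)).eq (atCut_zero H)
  step _ hc := ⟨_, (h.atCut_states hk hc.le).isContinuation (h.atCut_states hk hc) h.le h.two
    (hc.trans hk)⟩
  last := hb _ (h.atCut_states hk le_rfl)
  after _ := states_of_lt

/-- Reflecting the graph reflects its states. -/
theorem AtCut.comap_reflH {c : ℕ} {s : State m} (h : AtCut H c s) :
    AtCut (H.comap reflH) c s.flip where
  edges r := (s.hasEdge_flip r).trans (h.edges r.rev)
  cap := by
    refine h.cap.transport involutive_reflH.toPerm Fin.revPerm (fun u v => ?_) (fun v => Iff.rfl)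
      (fun r => rfl) fun r => ?_
    · change H.Adj (reflH (reflH u)) (reflH (reflH v)) ↔ _
      rw [involutive_reflH, involutive_reflH]
    · change (s.1 r.rev.rev).rev = (s.1 r).rev
      rw [Fin.rev_rev]

namespace IsCutScheme

/-- The correspondence restricts to the cycles and sequences with corresponding further
properties. -/
theorem ncard_eq_of_iff (hs : IsCutScheme k C b) {Q : SimpleGraph (Fin m × Fin m) → Prop}
    {Q' : (ℕ → State m) → Prop} (hQ : ∀ H, IsHam H → C H → (Q H ↔ Q' (states k H))) :
    {H | IsHam H ∧ C H ∧ Q H}.ncard =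
      {F | IsSeq (State.empty m) Continues b k (State.empty m) F ∧ Q' F}.ncard := by
  refine Set.ncard_congr (fun H _ => states k H) ?_ ?_ ?_
  · rintro H ⟨h1, h2, h3⟩
    exact ⟨h1.isSeq_states hs.lt (hs.last H h1 h2), (hQ H h1 h2).1 h3⟩
  · rintro H H' ⟨h1, h2, -⟩ ⟨h1', h2', -⟩ he
    refine hs.det H H' h1 h1' h2 h2' fun c _ hc r => ?_
    rw [← (h1.atCut_states hs.lt hc).edges, he, (h1'.atCut_states hs.lt hc).edges]
  · rintro F ⟨hF, hF'⟩
    obtain ⟨H, h1, h2, h3⟩ := hs.exists_isHam F hF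
    have he : states k H = F := by
      funext c
      by_cases hc : c ≤ k
      · exact (h1.atCut_states hs.lt hc).eq (h3 c hc)
      · rw [states_of_lt (not_le.1 hc), hF.after c (not_le.1 hc)]
    exact ⟨H, ⟨h1, h2, (hQ H h1 h2).2 (he ▸ hF')⟩, he⟩

/-- A cycle is symmetric exactly when its states are. -/
theorem inv_reflH_iff (hs : IsCutScheme k C b) (h : IsHam H) (hC : C H) :
    Inv reflH H ↔ ∀ i, (states k H i).IsSymmetric := by
  constructor
  · intro hi c
    have he : H.comap reflH = H := by
      ext u v
      exact hi u v
    by_cases hc : c ≤ k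
    · have h1 := h.atCut_states hs.lt hc
      have h2 := h1.comap_reflH
      rw [he] at h2
      exact h2.eq h1
    · rw [states_of_lt (not_le.1 hc)]
      exact Subtype.ext (funext fun r => Fin.rev_rev r)
  · intro hi
    have h' : IsHam (H.comap reflH) := h.comap involutive_reflH.toPerm inv_reflH_grid
    have he : H.comap reflH = H := by
      refine hs.det _ _ h' h (hs.refl H hC) hC fun c _ hc r => ?_
      have h1 := h.atCut_states hs.lt hc
      rw [← h1.comap_reflH.edges, ← h1.edges, hi c]
    intro u v
    exact (congrArg (fun G => G.Adj u v) he).to_iff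

theorem ncard_eq (hs : IsCutScheme k C b) (hk : 0 < k) :
    {H | IsHam H ∧ C H}.ncard =
      (fun s => ind (b s)) ⬝ᵥ ((T m ^ (k - 1)) *ᵥ alpha m) := by
  have h1 := hs.ncard_eq_of_iff (Q := fun _ => True) (Q' := fun _ => True)
    fun _ _ _ => Iff.rfl
  simp only [and_true] at h1
  have h2 := ncard_isSeq (State.empty m) Continues b (T m) T_apply (alpha m)
    (fun s => ind (b s)) alpha_eq_ind (fun _ => rfl) (k - 1)
  rw [Nat.sub_add_cancel hk] at h2
  rw [h1, h2]

theorem ncard_symmetric_eq (hs : IsCutScheme k C b) (hk : 0 < k) :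
    {H | IsHam H ∧ C H ∧ Inv reflH H}.ncard =
      (fun s : SymState m => ind (b s.1)) ⬝ᵥ ((TBar m ^ (k - 1)) *ᵥ alphaBar m) := by
  have hd : (State.empty m).IsSymmetric := Subtype.ext (funext fun r => Fin.rev_rev r)
  have h1 := ncard_isSeq (S := SymState m) ⟨State.empty m, hd⟩
    (fun s s' => ∃ V, State.IsContinuation s.1 V s'.1 ∧ IsSymmetricColumn V)
    (fun s => b s.1) (TBar m) TBar_apply (alphaBar m) (fun s => ind (b s.1))
    (alphaBar_eq_ind hd) (fun _ => rfl) (k - 1)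
  rw [Nat.sub_add_cancel hk] at h1
  rw [← h1, ← ncard_isSeq_symState b k hd]
  exact hs.ncard_eq_of_iff (Q' := fun F => ∀ i, (F i).IsSymmetric) fun H h hC =>
    hs.inv_reflH_iff h hC

end IsCutScheme

/-- A sequence of continuations in the columns of a 2-regular graph gives its states. -/
theorem atCut_of_isContinuation (hH : H ≤ grid m) (h2 : IsTwoRegular H) {F : ℕ → State m}
    (hk : k < m) (h0 : F 0 = State.empty m)
    (hedge : ∀ c, 0 < c → c ≤ k → ∀ r, (F c).HasEdge r ↔ hor H c r)
    (hstep : ∀ c, c < k → State.IsContinuation (F c) (ver H c) (F (c + 1))) {c : ℕ} (hc : c ≤ k) :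
    AtCut H c (F c) := by
  induction c with
  | zero => rw [h0]; exact atCut_zero H
  | succ c ih =>
    exact (ih (by omega)).succ (hstep c hc) (hedge (c + 1) (Nat.succ_pos c) hc) hH h2 (by omega)

/-- All Hamiltonian cycles, cut at all columns. -/
theorem isCutScheme_isEnding (hm : 1 < m) :
    IsCutScheme (m := m) (m - 1) (fun _ => True) State.IsEnding where
  lt := by omega
  det H H' h h' _ _ hh :=
    eq_of_hor_iff h.le h'.le h.two h'.two fun c h0 hc => hh c h0 (by omega)
  last H h _ s hs :=
    ⟨ver H (m - 1), ver_le_pathGraph h.le _, hs.deg_add_eq_two h.le h.two (by omega),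
      (hs.connected_iff h.le (by omega)).1 h.conn⟩
  exists_isHam := by
    rintro F ⟨h0, hstep, ⟨W, hW, hWdeg, hWconn⟩, hafter⟩
    choose! V hV using hstep
    let V' : ℕ → SimpleGraph (Fin m) := fun c => if c < m - 1 then V c else W
    have hV' : ∀ c, c < m - 1 → V' c = V c := fun c hc => if_pos hc
    have hW' : V' (m - 1) = W := if_neg (lt_irrefl _)
    have hle : ∀ c, c < m → V' c ≤ pathGraph m := fun c hc => by
      by_cases h : c < m - 1
      · rw [hV' c h]; exact (hV c h).vertical
      · obtain rfl : c = m - 1 := by omega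
        rw [hW']; exact hW
    have hgrid := build_le_grid (h := fun c r => (F c).HasEdge r) hle
    have h2 : IsTwoRegular (build (fun c r => (F c).HasEdge r) V') := by
      refine isTwoRegular_build hle (fun r => ?_) (fun r => ?_) fun c hc r => ?_
      · rw [h0]; exact State.not_hasEdge_empty r
      · rw [hafter m (by omega)]; exact State.not_hasEdge_empty r
      · by_cases h : c < m - 1
        · rw [hV' c h]; exact (hV c h).degree_two r
        · obtain rfl : c = m - 1 := by omega
          rw [hW', hafter (m - 1 + 1) (by omega)]
          have : ind ((State.empty m).HasEdge r) = 0 := if_neg (State.not_hasEdge_empty r)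
          rw [this]
          exact hWdeg r
    have hcut : ∀ c, c ≤ m - 1 → AtCut (build (fun c r => (F c).HasEdge r) V') c (F c) :=
      fun c hc => atCut_of_isContinuation hgrid h2 (by omega) h0
        (fun c h0 hc r => (hor_build (h := fun c r => (F c).HasEdge r) h0 (by omega) r).symm)
        (fun c hc => by rw [ver_build (by omega), hV' c hc]; exact hV c hc) hc
    refine ⟨_, ⟨hgrid, h2, ((hcut _ le_rfl).connected_iff hgrid (by omega)).2 ?_⟩, trivial, hcut⟩
    rw [ver_build (by omega), hW']
    exact hWconn
  refl _ _ := trivial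

/-- The map of the square that acts on the rows by `σ` and reverses the columns. -/
def turn (σ : Fin m ≃ Fin m) : Fin m × Fin m ≃ Fin m × Fin m := Equiv.prodCongr σ Fin.revPerm

theorem rev_col_pred {c : ℕ} (h0 : 0 < c) (hc : c ≤ m) :
    (col m (c - 1)).rev = col m (m - c) := by
  refine eq_col ?_
  rw [Fin.val_rev, val_col (by omega)]
  omega

theorem hor_turn_iff {σ : Fin m ≃ Fin m} (hinv : Inv (turn σ) H) {c : ℕ} (h0 : 0 < c) (hc : c < m)
    (r : Fin m) : hor H (m - c) (σ r) ↔ hor H c r := by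
  have h1 := hinv (r, col m (c - 1)) (r, col m c)
  have e1 : turn σ (r, col m (c - 1)) = (σ r, col m (m - c)) :=
    Prod.ext rfl (rev_col_pred h0 hc.le)
  have e2 : turn σ (r, col m c) = (σ r, col m (m - c - 1)) :=
    Prod.ext rfl (rev_col_pred (m := m) (Nat.succ_pos c) hc)
  rw [e1, e2] at h1
  rw [hor, hor, ← h1, adj_comm]
  exact and_congr_left fun _ => iff_of_true (by omega) hc

/-- A graph that is invariant under a map exchanging left and right is connected exactly when the
state at the central cut and its image close to a single cycle. -/
theorem AtCut.connected_iff_closes {n : ℕ} (hmn : m = 2 * n) (hn : 0 < n) {s t : State m}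
    (h : AtCut H n s) (hH : H ≤ grid m) {σ : Fin m ≃ Fin m} (hinv : Inv (turn σ) H)
    (ht : ∀ r, t.1 (σ r) = σ (s.1 r)) : H.Connected ↔ s.Closes t := by
  have hst : ∀ r, s.HasEdge r ↔ t.HasEdge r := fun r => by
    obtain ⟨r, rfl⟩ := σ.surjective r
    have h1 : t.HasEdge (σ r) ↔ s.HasEdge r := by
      rw [State.HasEdge, ht, σ.injective.ne_iff]; rfl
    have h2 := hor_turn_iff hinv hn (by omega : n < m) r
    rw [show m - n = n by omega, ← h.edges, ← h.edges] at h2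
    exact h2.trans h1.symm
  have hcap : IsCap H (cols m n)ᶜ (fun r => (r, col m n)) t := by
    refine h.cap.transport (turn σ) σ hinv (fun v => ?_) (fun r => ?_) ht
    · change ¬ (v.2.rev.val < n) ↔ v.2.val < n
      rw [Fin.val_rev]
      omega
    · refine Prod.ext rfl ?_
      change col m n = (col m (n - 1)).rev
      rw [rev_col_pred hn (by omega), show m - n = n by omega]
  refine h.cap.connected_iff_closes hcap disjoint_compl_right (Set.union_compl_self _) hst
    ⟨cutEnd n 0, cutEnd_mem_cols hn (by omega) 0⟩ (fun r hr => mem_cols_of_hor ((h.edges r).1 hr))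
    (fun r _ hr => ?_) fun u hu v hv => ?_
  · have : (col m n).val < n := hr
    rw [val_col (by omega)] at this
    omega
  · simp only [h.edges]
    exact adj_across_iff hH hu hv

/-- The Hamiltonian cycles that are invariant under a map exchanging left and right, cut along the
central line. Here `t s` is the image of the state `s`, as seen from the other side. -/
theorem isCutScheme_closes {n : ℕ} (hmn : m = 2 * n) (hn : 0 < n) (σ : Fin m ≃ Fin m)
    (hσ : Function.Involutive σ)
    (hpath : ∀ r r', (pathGraph m).Adj (σ r) (σ r') ↔ (pathGraph m).Adj r r')
    (hrev : ∀ r, σ r.rev = (σ r).rev) (t : State m → State m)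
    (ht : ∀ s r, (t s).1 (σ r) = σ (s.1 r)) :
    IsCutScheme n (Inv (turn σ)) (fun s => s.Closes (t s)) where
  lt := by omega
  det H H' h h' hC hC' hh := by
    refine eq_of_hor_iff h.le h'.le h.two h'.two fun c h0 hc r => ?_
    by_cases hcn : c ≤ n
    · exact hh c h0 hcn r
    · rw [← hor_turn_iff hC h0 hc, ← hor_turn_iff hC' h0 hc]
      exact hh _ (by omega) (by omega) _
  last H h hC s hs := (hs.connected_iff_closes hmn hn h.le hC (ht s)).1 h.conn
  exists_isHam := by
    rintro F ⟨h0, hstep, hclose, -⟩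
    choose! V hV using hstep
    -- the right half is the image of the left half
    let h : ℕ → Fin m → Prop := fun c r =>
      if c ≤ n then (F c).HasEdge r else (F (m - c)).HasEdge (σ r)
    let V' : ℕ → SimpleGraph (Fin m) := fun c =>
      if c < n then V c else (V (m - 1 - c)).comap σ
    -- closing up makes the central cut symmetric, so that both descriptions of `h` agree there
    have hn' : ∀ r, (F n).HasEdge (σ r) ↔ (F n).HasEdge r := fun r => by
      rw [hclose.1 (σ r), State.HasEdge, ht, σ.injective.ne_iff]; rfl
    have hl : ∀ c, c ≤ n → ∀ r, h c r ↔ (F c).HasEdge r := fun c hc r => by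
      simp only [h, if_pos hc]
    have hr : ∀ c, n ≤ c → ∀ r, h c r ↔ (F (m - c)).HasEdge (σ r) := fun c hc r => by
      rcases hc.eq_or_lt with rfl | hc
      · rw [hl n le_rfl, show m - n = n by omega, hn']
      · simp only [h, if_neg (not_le.2 hc)]
    have hVl : ∀ c, c < n → V' c = V c := fun c hc => if_pos hc
    have hVr : ∀ c, n ≤ c → V' c = (V (m - 1 - c)).comap σ := fun c hc => if_neg (not_lt.2 hc)
    have hh : ∀ c, c ≤ m → ∀ r, h (m - c) (σ r) ↔ h c r := fun c hc r => by
      by_cases hcn : c ≤ n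
      · rw [hl c hcn, hr _ (by omega), hσ r, Nat.sub_sub_self hc]
      · rw [hr c (by omega), hl _ (by omega)]
    have hVV : ∀ c, c < m → ∀ r r', (V' (m - 1 - c)).Adj (σ r) (σ r') ↔ (V' c).Adj r r' :=
      fun c hc r r' => by
        by_cases hcn : c < n
        · rw [hVl c hcn, hVr _ (by omega), comap_adj, hσ r, hσ r', Nat.sub_sub_self (by omega)]
        · rw [hVr c (by omega), hVl _ (by omega), comap_adj]
    have hle : ∀ c, c < m → V' c ≤ pathGraph m := fun c hc => by
      by_cases hcn : c < n
      · rw [hVl c hcn]; exact (hV c hcn).vertical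
      · rw [hVr c (by omega)]
        exact fun r r' hadj => (hpath r r').1 ((hV _ (by omega)).vertical hadj)
    have hgrid := build_le_grid (h := h) hle
    have h2 : IsTwoRegular (build h V') := by
      refine isTwoRegular_build hle (fun r => ?_) (fun r => ?_) fun c hc r => ?_
      · rw [hl 0 (Nat.zero_le n), h0]; exact State.not_hasEdge_empty r
      · rw [hr m (by omega), Nat.sub_self, h0]; exact State.not_hasEdge_empty _
      · by_cases hcn : c < n
        · rw [hVl c hcn, propext (hl c hcn.le r), propext (hl (c + 1) hcn r)]
          exact (hV c hcn).degree_two r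
        · rw [hVr c (by omega), propext (hr c (by omega) r), propext (hr (c + 1) (by omega) r),
            ncard_neighborSet_comap]
          have := (hV (m - 1 - c) (by omega)).degree_two (σ r)
          rw [State.deg_eq_ind, State.deg_eq_ind, show m - 1 - c + 1 = m - c by omega,
            Nat.sub_sub, Nat.add_comm 1 c] at this
          rw [Nat.sub_sub, Nat.add_comm 1 c]
          omega
    have hinv : Inv (turn σ) (build h V') := by
      rintro ⟨a, b⟩ ⟨a', b'⟩
      have hside : ∀ x y : Fin m, (y.rev.val + 1 = x.rev.val ∧ h x.rev.val (σ a)) ↔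
          (x.val + 1 = y.val ∧ h y.val a) := fun x y => by
        have hx := x.2
        have hy := y.2
        rw [← hh y.val y.2.le a, Fin.val_rev, Fin.val_rev]
        constructor
        · rintro ⟨h1, h3⟩
          have h1 : x.val + 1 = y.val := by omega
          exact ⟨h1, h1 ▸ h3⟩
        · rintro ⟨h1, h3⟩
          exact ⟨by omega, h1 ▸ h3⟩
      refine or_congr (and_congr σ.injective.eq_iff (Iff.trans or_comm (or_congr ?_ ?_)))
        (and_congr Fin.rev_injective.eq_iff ?_)
      · exact hside b b'
      · exact hside b' b
      · change (V' b.rev.val).Adj (σ a) (σ a') ↔ _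
        rw [← hVV b.val b.2, Fin.val_rev, Nat.sub_sub, Nat.add_comm 1]
    have hcut : ∀ c, c ≤ n → AtCut (build h V') c (F c) :=
      fun c hc => atCut_of_isContinuation hgrid h2 (by omega) h0
        (fun c h0 hc r => ((hor_build h0 (by omega) r).trans (hl c hc r)).symm)
        (fun c hc => by rw [ver_build (by omega), hVl c hc]; exact hV c hc) hc
    exact ⟨_, ⟨hgrid, h2,
      ((hcut n le_rfl).connected_iff_closes hmn hn hgrid hinv (ht _)).2 hclose⟩, hinv, hcut⟩
  refl H hC := by
    have hcomm : ∀ u, reflH (turn σ u) = turn σ (reflH u) := fun u =>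
      Prod.ext (hrev u.1).symm rfl
    intro u v
    rw [comap_adj, hcomm, hcomm, hC, comap_adj]

end Schemes

theorem isCutScheme_reflV {n : ℕ} [NeZero (2 * n)] (hn : 0 < n) :
    IsCutScheme (m := 2 * n) n (Inv reflV) State.ClosesByReflection :=
  isCutScheme_closes rfl hn (Equiv.refl _) (fun _ => rfl) (fun _ _ => Iff.rfl) (fun _ => rfl) id
    fun _ _ => rfl

theorem isCutScheme_rot180 {n : ℕ} [NeZero (2 * n)] (hn : 0 < n) :
    IsCutScheme (m := 2 * n) n (Inv rot180) State.ClosesByRotation :=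
  isCutScheme_closes rfl hn Fin.revPerm Fin.rev_rev pathGraph_adj_rev (fun _ => rfl) State.flip
    fun s r => by
      change (s.1 r.rev.rev).rev = (s.1 r).rev
      rw [Fin.rev_rev]

theorem lam_eq_ind (m : ℕ) : lam m = fun s => ind s.ClosesByReflection :=
  funext fun s => congrArg ind (propext s.isSinglePair_iff_closesByReflection)

theorem invariantUnder_both_iff {m : ℕ} (H : SimpleGraph (Fin m × Fin m)) :
    (InvariantUnder reflH H.edgeSet ∧ InvariantUnder reflV H.edgeSet ∧
      InvariantUnder rot180 H.edgeSet) ↔ Inv reflV H ∧ Inv reflH H := by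
  rw [invariantUnder_edgeSet_iff involutive_reflH, invariantUnder_edgeSet_iff involutive_reflV,
    invariantUnder_edgeSet_iff involutive_rot180]
  refine ⟨fun h => ⟨h.2.1, h.1⟩, fun h => ⟨h.2, h.1, fun u v => ?_⟩⟩
  exact (h.2 (reflV u) (reflV v)).trans (h.1 u v)

end GridCycle

open GridCycle in
theorem mainTheorem4 (n : ℕ) (hn : 1 ≤ n) :
    -- the count `B` does not depend on the axis, and is given by both formulas
    GridCycle.countBV (2 * n) = GridCycle.countBH (2 * n) ∧
    GridCycle.countBH (2 * n) = GridCycle.omegaBar (2 * n) ⬝ᵥ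
      ((GridCycle.TBar (2 * n) ^ (2 * n - 2)) *ᵥ GridCycle.alphaBar (2 * n)) ∧
    GridCycle.countBH (2 * n) = GridCycle.lam (2 * n) ⬝ᵥ
      ((GridCycle.T (2 * n) ^ (n - 1)) *ᵥ GridCycle.alpha (2 * n)) ∧
    GridCycle.countC (2 * n) = GridCycle.mu (2 * n) ⬝ᵥ
      ((GridCycle.T (2 * n) ^ (n - 1)) *ᵥ GridCycle.alpha (2 * n)) ∧
    GridCycle.countD (2 * n) = GridCycle.lamBar (2 * n) ⬝ᵥ
      ((GridCycle.TBar (2 * n) ^ (n - 1)) *ᵥ GridCycle.alphaBar (2 * n)) ∧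
    -- the vectors `λ` and `μ` pick out the states that close up to a single cycle
    (∀ s : GridCycle.State (2 * n), s.IsSinglePair ↔ s.ClosesByReflection) ∧
    GridCycle.muBar (2 * n) = GridCycle.lamBar (2 * n) := by
  have : NeZero (2 * n) := ⟨by omega⟩
  refine ⟨countBV_eq_countBH, ?_, ?_, ?_, ?_, State.isSinglePair_iff_closesByReflection, ?_⟩
  · have h := (isCutScheme_isEnding (m := 2 * n) (by omega)).ncard_symmetric_eq (by omega)
    rw [Nat.sub_sub] at h
    simp only [true_and] at h
    rw [countBH, ncard_hamCycles (invariantUnder_edgeSet_iff involutive_reflH), h]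
    rfl
  · rw [← countBV_eq_countBH, countBV,
      ncard_hamCycles (invariantUnder_edgeSet_iff involutive_reflV),
      (isCutScheme_reflV hn).ncard_eq hn, lam_eq_ind]
  · rw [countC, ncard_hamCycles (invariantUnder_edgeSet_iff involutive_rot180),
      (isCutScheme_rot180 hn).ncard_eq hn]
    rfl
  · have hlam : lamBar (2 * n) = fun s => ind s.1.ClosesByReflection :=
      funext fun s => congrFun (lam_eq_ind (2 * n)) s.1
    rw [countD, ncard_hamCycles invariantUnder_both_iff,
      (isCutScheme_reflV hn).ncard_symmetric_eq hn, hlam]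
  · funext s
    exact (congrArg ind (propext s.2.closesByRotation_iff)).trans
      (congrFun (lam_eq_ind (2 * n)) s.1).symm
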